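/- Let $f:\mathbb R^n\to\mathbb R$ be convex and $L$-smooth ($L>0$: $f$ is differentiable and $\|\nabla f(x)-\nabla f(y)\|_2\le L\|x-y\|_2$ for all $x,y$), with a minimizer $x^*$. Let $\xi\sim P$ and let $\nabla f(x,\xi)$, jointly measurable in $(x,\xi)$, be stochastic gradients with $\mathbb E_\xi[\nabla f(x,\xi)]=\nabla f(x)$ and $\mathbb E_\xi\|\nabla f(x,\xi)-\nabla f(x)\|_2^2\le\sigma^2$ for all $x$, where $\sigma\ge 0$; nothing else is assumed on their tails. Let $x^0\in\mathbb R^n$ with $R_0=\|x^0-x^*\|_2>0$. Given $N\ge1$, batch sizes $m_0,\dots,m_{N-1}$, $a>0$ and $B>0$, the method clipped-SSTM sets $A_0=\alpha_0=0$, $y^0=z^0=x^0$ and, for $k=0,\dots,N-1$, $$\alpha_{k+1}=\frac{k+2}{2aL},\quad A_{k+1}=A_k+\alpha_{k+1},\quad x^{k+1}=\frac{A_ky^k+\alpha_{k+1}z^k}{A_{k+1}},\quad g^{k+1}=\frac1{m_k}\sum_{i=1}^{m_k}\nabla f(x^{k+1},\xi_i^k),$$ $$z^{k+1}=z^k-\alpha_{k+1}\min\Big\{1,\frac{B}{\alpha_{k+1}\|g^{k+1}\|_2}\Big\}g^{k+1},\qquad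 y^{k+1}=\frac{A_ky^k+\alpha_{k+1}z^{k+1}}{A_{k+1}},$$ where all the samples $\xi_i^k$ are independent with law $P$ (and a vector $g^{k+1}=0$ is left unchanged by the clipping). It returns $y^N$ and makes $\sum_{k=0}^{N-1}m_k$ oracle calls. Put $C=\sqrt5$ and, for $\beta\in(0,1)$ and $N\ge1$, $$\hat a(N,\beta)=\max\Big\{1,\ \frac{16\ln\frac{4N}\beta}{C},\ 36\Big(2\ln\tfrac{4N}\beta+\sqrt{4\ln^2\tfrac{4N}\beta+2\ln\tfrac{4N}\beta}\Big)^2\Big\}.$$ The parameters of the method are always $$m_k=\Big\lceil\max\Big\{1,\frac{6000\sigma^2\alpha_{k+1}^2N\ln\frac{4N}\beta}{C^2R_0^2},\frac{10368\sigma^2\alpha_{k+1}^2N}{C^2R_0^2}\Big\}\Big\rceil,\qquad B=\frac{CR_0}{8\ln\frac{4N}\beta}.$$ **(i)** For all $\beta\in(0,1)$ and $N\ge1$ with $\ln\frac{4N}\beta\ge2$ and all $a\ge\hat a(N,\beta)$, after $N$ iterations of clipped-SSTM, with probability at least $1-\beta$, $$f(y^N)-f(x^*)\le\frac{2aLC^2R_0^2}{N(N+3)}.$$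 **(ii)** There is an absolute constant $K>0$ such that for all $L>0$, $\sigma\ge0$, $R_0>0$, $\beta\in(0,1)$ and $0<\varepsilon\le LR_0^2/2$ there is an $N\ge1$ with $\ln\frac{4N}\beta\ge2$, depending only on these five numbers, such that for every $n$ and every problem, stochastic gradient, starting point and minimizer as above, clipped-SSTM with $a=\hat a(N,\beta)$ satisfies $f(y^N)-f(x^*)\le\varepsilon$ with probability at least $1-\beta$, and $$N\le K\sqrt{\frac{LR_0^2}\varepsilon}\,\ln\frac{LR_0^2}{\varepsilon\beta},\qquad\sum_{k=0}^{N-1}m_k\le K\max\Big\{\sqrt{\frac{LR_0^2}\varepsilon},\frac{\sigma^2R_0^2}{\varepsilon^2}\Big\}\ln\frac{LR_0^2}{\varepsilon\beta}.$$ -/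

import Mathlib

open MeasureTheory ProbabilityTheory

namespace ClippedSSTM

noncomputable section

/-- `L`-smoothness on the whole space: `f` is differentiable and its gradient is
`L`-Lipschitz. -/
structure IsLSmooth {n : ℕ} (f : EuclideanSpace ℝ (Fin n) → ℝ) (L : ℝ) : Prop where
  differentiable : Differentiable ℝ f
  gradient_lipschitz : ∀ x y, ‖gradient f x - gradient f y‖ ≤ L * ‖x - y‖

/-- `g x ξ`, with `ξ` distributed according to `P`, is an unbiased stochastic gradient of `f`
whose variance is at most `σ ^ 2` at every point. -/
structure IsStochasticGradient {n : ℕ} {Ξ : Type*} [MeasurableSpace Ξ]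
    (f : EuclideanSpace ℝ (Fin n) → ℝ) (P : Measure Ξ)
    (g : EuclideanSpace ℝ (Fin n) → Ξ → EuclideanSpace ℝ (Fin n)) (σ : ℝ) : Prop where
  measurable : Measurable (Function.uncurry g)
  integrable : ∀ x, Integrable (g x) P
  unbiased : ∀ x, ∫ s, g x s ∂P = gradient f x
  integrable_sq : ∀ x, Integrable (fun s => ‖g x s - gradient f x‖ ^ 2) P
  variance_le : ∀ x, ∫ s, ‖g x s - gradient f x‖ ^ 2 ∂P ≤ σ ^ 2

/-- The random variables `ξ k i` (the `i`-th sample available at iteration `k`) are independent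
and all have law `P`. -/
structure IsIIDSample {Ω Ξ : Type*} [MeasurableSpace Ω] [MeasurableSpace Ξ]
    (μ : Measure Ω) (P : Measure Ξ) (ξ : ℕ → ℕ → Ω → Ξ) : Prop where
  measurable : ∀ k i, Measurable (ξ k i)
  law : ∀ k i, μ.map (ξ k i) = P
  indep : iIndepFun (fun p : ℕ × ℕ => ξ p.1 p.2) μ

/-! ### The algorithm -/

/-- Clipping: `clip v l = min {1, l / ‖v‖} v` (and `clip 0 l = 0`). -/
def clip {n : ℕ} (v : EuclideanSpace ℝ (Fin n)) (l : ℝ) : EuclideanSpace ℝ (Fin n) :=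
  min 1 (l / ‖v‖) • v

/-- The mini-batched stochastic gradient at `x` computed from the samples `s 0, …, s (m - 1)`. -/
def miniBatch {n : ℕ} {Ξ : Type*}
    (g : EuclideanSpace ℝ (Fin n) → Ξ → EuclideanSpace ℝ (Fin n))
    (m : ℕ) (s : ℕ → Ξ) (x : EuclideanSpace ℝ (Fin n)) : EuclideanSpace ℝ (Fin n) :=
  (1 / (m : ℝ)) • ∑ i ∈ Finset.range m, g x (s i)

/-- `α₀ = 0` and `α_{k+1} = (k + 2) / (2 a L)`. -/
def alpha (a L : ℝ) : ℕ → ℝ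
  | 0 => 0
  | k + 1 => ((k : ℝ) + 2) / (2 * a * L)

/-- `A₀ = 0` and `A_{k+1} = A_k + α_{k+1}`. -/
def bigA (a L : ℝ) : ℕ → ℝ
  | 0 => 0
  | k + 1 => bigA a L k + alpha a L (k + 1)

/-- The pair `(y^k, z^k)` kept by the method between two iterations. -/
structure State (n : ℕ) where
  y : EuclideanSpace ℝ (Fin n)
  z : EuclideanSpace ℝ (Fin n)

/-- One iteration of clipped-SSTM, from `(y^k, z^k)` to `(y^{k+1}, z^{k+1})`, with batch size `m`,
samples `s 0, …, s (m - 1)` and clipping level `λ_{k+1} = B / α_{k+1}`. -/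
def step {n : ℕ} {Ξ : Type*}
    (g : EuclideanSpace ℝ (Fin n) → Ξ → EuclideanSpace ℝ (Fin n))
    (a L B : ℝ) (k m : ℕ) (s : ℕ → Ξ) (S : State n) : State n :=
  let x := (1 / bigA a L (k + 1)) • (bigA a L k • S.y + alpha a L (k + 1) • S.z)
  let z' := S.z - alpha a L (k + 1) • clip (miniBatch g m s x) (B / alpha a L (k + 1))
  { y := (1 / bigA a L (k + 1)) • (bigA a L k • S.y + alpha a L (k + 1) • z')
    z := z' }

/-- The state of clipped-SSTM after `k` iterations from `x0`, with batch sizes `m`, stepsize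
parameter `a`, smoothness constant `L` and clipping parameter `B`, where `s k i` is the `i`-th
sample drawn at iteration `k`. -/
def run {n : ℕ} {Ξ : Type*}
    (g : EuclideanSpace ℝ (Fin n) → Ξ → EuclideanSpace ℝ (Fin n))
    (x0 : EuclideanSpace ℝ (Fin n)) (a L B : ℝ) (m : ℕ → ℕ) (s : ℕ → ℕ → Ξ) : ℕ → State n
  | 0 => { y := x0, z := x0 }
  | k + 1 => step g a L B k (m k) (s k) (run g x0 a L B m s k)

/-- The number of stochastic gradients evaluated during the first `N` iterations. -/
def oracleCalls (m : ℕ → ℕ) (N : ℕ) : ℕ := ∑ k ∈ Finset.range N, m k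

/-! ### The parameters -/

/-- The constant `C = √5`. -/
def constC : ℝ := √5

/-- `ln (4 N / β)`. -/
def logFactor (N : ℕ) (β : ℝ) : ℝ := Real.log (4 * (N : ℝ) / β)

/-- The clipping parameter `B = C R₀ / (8 ln (4 N / β))`. -/
def clipParam (R0 β : ℝ) (N : ℕ) : ℝ := constC * R0 / (8 * logFactor N β)

/-- The lower bound on the stepsize parameter `a`. -/
def aMin (β : ℝ) (N : ℕ) : ℝ :=
  max 1 (max (16 * logFactor N β / constC)
    (36 * (2 * logFactor N β + √(4 * logFactor N β ^ 2 + 2 * logFactor N β)) ^ 2))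

/-- The batch sizes `m_k`, rounded up to an integer. -/
def batchSize (L σ R0 a β : ℝ) (N k : ℕ) : ℕ :=
  ⌈max 1 (max
    (6000 * σ ^ 2 * alpha a L (k + 1) ^ 2 * (N : ℝ) * logFactor N β / (constC ^ 2 * R0 ^ 2))
    (10368 * σ ^ 2 * alpha a L (k + 1) ^ 2 * (N : ℝ) / (constC ^ 2 * R0 ^ 2)))⌉₊

/-- The output `y^N` of clipped-SSTM run for `N` iterations with the batch sizes and the clipping
parameter above. -/
def output {n : ℕ} {Ξ : Type*}
    (g : EuclideanSpace ℝ (Fin n) → Ξ → EuclideanSpace ℝ (Fin n))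
    (x0 : EuclideanSpace ℝ (Fin n)) (L σ R0 a β : ℝ) (N : ℕ) (s : ℕ → ℕ → Ξ) :
    EuclideanSpace ℝ (Fin n) :=
  (run g x0 a L (clipParam R0 β N) (batchSize L σ R0 a β N) s N).y

end

end ClippedSSTM

/-!
Write `D = √5 R₀`, `l = ln (4 N / β)` and `B = D / (8 l)`. In iteration `k` the potential
`A_k (f(y^k) - f(x^*)) + ‖z^k - x^*‖² / 2` increases by at most a noise term
`⟨e, x^* - z^k + α_{k+1} ∇f(x^{k+1})⟩ + ‖e‖²`, where `e` is `α_{k+1}` times the error of the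
clipped gradient. As long as the accumulated noise stays below `2 R₀²`, the potential is at most
`D² / 2`, so `y^k` and `z^k` lie within `D` of `x^*`, and the lower bound on `a` then gives
`α_{k+1} ‖∇f(x^{k+1})‖ ≤ B / 2`. Under this bound `e` has norm at most `3 B / 2`, second moment at
most `α_{k+1}² σ² / m_k` and mean of norm at most `α_{k+1}² σ² / (2 B m_k)`, with no assumption on
the tails of the stochastic gradients.

The noise is accumulated only until its sum exceeds `2 R₀²`, so the bounds above hold for every
term of the sum. For `λ = 4 l / D²` we have `|λ · noise| ≤ 1`, so the inequality
`exp t ≤ 1 + t + t²` for `|t| ≤ 1` shows that the expectation of the exponential of `λ` times this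
sum grows by a factor of at most `exp (l / (100 N))` per iteration. By Markov's inequality the sum
exceeds `2 R₀²` with probability at most `exp (l / 100 - 8 l / 5) ≤ exp (-l) ≤ β`.

For the complexity, `a` is of order `l²`, so with `X = L R₀² / ε` the bound `a X / N² ≲ 1` is met
by some `N` of order `√X ln (X / β)`, for which `l` is of order `ln (X / β)`.
-/

namespace ClippedSSTM

/-! ### Convex and smooth functions on a Hilbert space -/

section Smooth

variable {E : Type*} [NormedAddCommGroup E] [InnerProductSpace ℝ E]

lemma sq_norm_sub_smul_sub (z v u : E) (α : ℝ) :
    ‖z - α • v - u‖ ^ 2 = ‖z - u‖ ^ 2 + 2 * α * inner ℝ v (u - z) + α ^ 2 * ‖v‖ ^ 2 := by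
  rw [sub_right_comm, norm_sub_sq_real, inner_smul_right, real_inner_comm, ← neg_sub u z,
    inner_neg_right, norm_smul, mul_pow, Real.norm_eq_abs, sq_abs]
  ring

variable [CompleteSpace E] {f : E → ℝ} {L : ℝ}

lemma hasDerivAt_comp_lineMap {x y : E} {t : ℝ}
    (hf : DifferentiableAt ℝ f (AffineMap.lineMap x y t)) :
    HasDerivAt (fun t : ℝ => f (AffineMap.lineMap x y t))
      (inner ℝ (gradient f (AffineMap.lineMap x y t)) (y - x)) t := by
  rw [inner_gradient_left]
  exact hf.hasFDerivAt.comp_hasDerivAt t AffineMap.hasDerivAt_lineMap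

lemma add_inner_gradient_le_of_convexOn {s : Set E} (hc : ConvexOn ℝ s f) {x y : E}
    (hx : x ∈ s) (hy : y ∈ s) (hf : DifferentiableAt ℝ f x) :
    f x + inner ℝ (gradient f x) (y - x) ≤ f y := by
  have hd : HasDerivAt (fun t : ℝ => f (AffineMap.lineMap x y t))
      (inner ℝ (gradient f x) (y - x)) 0 := by
    simpa only [AffineMap.lineMap_apply_zero] using
      hasDerivAt_comp_lineMap (f := f) (x := x) (y := y) (t := 0) (by simpa using hf)
  have hslope := (hc.comp_affineMap (AffineMap.lineMap x y : ℝ →ᵃ[ℝ] E)).le_slope_of_hasDerivAt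
    (x := 0) (y := 1) (by simpa using hx) (by simpa using hy) one_pos hd
  simp only [slope_def_field, Function.comp_apply, AffineMap.lineMap_apply_one,
    AffineMap.lineMap_apply_zero, sub_zero, div_one] at hslope
  linarith

lemma le_add_inner_gradient_add_sq (hf : Differentiable ℝ f)
    (hL : ∀ x y, ‖gradient f x - gradient f y‖ ≤ L * ‖x - y‖) (x y : E) :
    f y ≤ f x + inner ℝ (gradient f x) (y - x) + L / 2 * ‖y - x‖ ^ 2 := by
  set γ : ℝ → E := fun t => AffineMap.lineMap x y t with hγ
  have hd (t : ℝ) : HasDerivAt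
      (fun t : ℝ => f (γ t) - t * inner ℝ (gradient f x) (y - x) - L / 2 * t ^ 2 * ‖y - x‖ ^ 2)
      (inner ℝ (gradient f (γ t) - gradient f x) (y - x) - L * t * ‖y - x‖ ^ 2) t := by
    refine (((hasDerivAt_comp_lineMap (hf _)).sub ((hasDerivAt_id t).mul_const _)).sub
      ((((hasDerivAt_id t).pow 2).const_mul (L / 2)).mul_const (‖y - x‖ ^ 2))).congr_deriv ?_
    rw [inner_sub_left]
    simp only [hγ, id, Nat.cast_ofNat]
    ring
  have hderiv_nonpos {t : ℝ} (ht : 0 ≤ t) :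
      inner ℝ (gradient f (γ t) - gradient f x) (y - x) - L * t * ‖y - x‖ ^ 2 ≤ 0 := by
    have hγx : γ t - x = t • (y - x) := AffineMap.lineMap_vsub_left x y t
    have hlip := hL (γ t) x
    rw [hγx, norm_smul, Real.norm_of_nonneg ht] at hlip
    nlinarith [real_inner_le_norm (gradient f (γ t) - gradient f x) (y - x),
      mul_le_mul_of_nonneg_right hlip (norm_nonneg (y - x))]
  have hanti := antitoneOn_of_deriv_nonpos (convex_Icc (0 : ℝ) 1)
    (fun t _ => (hd t).continuousAt.continuousWithinAt)
    (fun t _ => (hd t).differentiableAt.differentiableWithinAt)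
    (fun t ht => (hd t).deriv.trans_le
      (hderiv_nonpos (interior_subset (s := Set.Icc (0 : ℝ) 1) ht).1))
  have h01 := hanti (Set.left_mem_Icc.2 zero_le_one) (Set.right_mem_Icc.2 zero_le_one) zero_le_one
  simp only [hγ, AffineMap.lineMap_apply_one, AffineMap.lineMap_apply_zero, one_mul, zero_mul,
    sub_zero, one_pow, mul_one, ne_eq, OfNat.ofNat_ne_zero, not_false_eq_true, zero_pow,
    mul_zero] at h01
  linarith

lemma map_sub_smul_le (hf : Differentiable ℝ f)
    (hL : ∀ x y, ‖gradient f x - gradient f y‖ ≤ L * ‖x - y‖) {η : ℝ} (hη : 0 ≤ η)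
    (hLη : L * η ≤ 1) (x v : E) :
    f (x - η • v) ≤ f x - η * inner ℝ (gradient f x) v + η / 2 * ‖v‖ ^ 2 := by
  have hdescent := le_add_inner_gradient_add_sq hf hL x (x - η • v)
  rw [show x - η • v - x = -(η • v) by abel, inner_neg_right, inner_smul_right, norm_neg,
    norm_smul, Real.norm_of_nonneg hη] at hdescent
  nlinarith [mul_le_mul_of_nonneg_right hLη (show 0 ≤ η * ‖v‖ ^ 2 by positivity)]

lemma sq_norm_gradient_le (hL0 : 0 < L) (hf : Differentiable ℝ f)
    (hL : ∀ x y, ‖gradient f x - gradient f y‖ ≤ L * ‖x - y‖) {xstar : E}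
    (hmin : IsMinOn f Set.univ xstar) (x : E) :
    ‖gradient f x‖ ^ 2 ≤ 2 * L * (f x - f xstar) := by
  have hdescent := map_sub_smul_le hf hL (inv_nonneg.2 hL0.le) (mul_inv_cancel₀ hL0.ne').le x
    (gradient f x)
  have hle : f xstar ≤ f (x - L⁻¹ • gradient f x) := hmin (Set.mem_univ _)
  rw [real_inner_self_eq_norm_sq] at hdescent
  have hgap : L⁻¹ / 2 * ‖gradient f x‖ ^ 2 ≤ f x - f xstar := by linarith
  calc ‖gradient f x‖ ^ 2 = 2 * L * (L⁻¹ / 2 * ‖gradient f x‖ ^ 2) := by field_simp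
    _ ≤ 2 * L * (f x - f xstar) := by gcongr

lemma gradient_eq_zero_of_isMinOn {xstar : E} (hmin : IsMinOn f Set.univ xstar) :
    gradient f xstar = 0 := by
  rw [gradient, (hmin.isLocalMin Filter.univ_mem).fderiv_eq_zero, map_zero]

lemma coupling_add_inner_gradient_le (hc : ConvexOn ℝ Set.univ f) {A α : ℝ} (hA : 0 ≤ A)
    (hα : 0 ≤ α) {x y z : E} (hf : DifferentiableAt ℝ f x)
    (hx : (A + α) • x = A • y + α • z) (u : E) :
    (A + α) * f x + α * inner ℝ (gradient f x) (u - z) ≤ A * f y + α * f u := by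
  have hsum : A • (y - x) + α • (u - x) = α • (u - z) := by
    linear_combination (norm := module) -hx
  have hinner : A * inner ℝ (gradient f x) (y - x) + α * inner ℝ (gradient f x) (u - x) =
      α * inner ℝ (gradient f x) (u - z) := by
    simp only [← inner_smul_right, ← inner_add_right, hsum]
  have hy := mul_le_mul_of_nonneg_left
    (add_inner_gradient_le_of_convexOn hc (Set.mem_univ x) (Set.mem_univ y) hf) hA
  have hu := mul_le_mul_of_nonneg_left
    (add_inner_gradient_le_of_convexOn hc (Set.mem_univ x) (Set.mem_univ u) hf) hα
  linarith

lemma coupling_step_le (hc : ConvexOn ℝ Set.univ f) (hf : Differentiable ℝ f)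
    (hL : ∀ x y, ‖gradient f x - gradient f y‖ ≤ L * ‖x - y‖) {A α : ℝ} (hA : 0 ≤ A)
    (hα : 0 < α) (hLα : L * α ^ 2 ≤ A + α) {x y z y' : E} (v u : E)
    (hx : (A + α) • x = A • y + α • z) (hy' : (A + α) • y' = A • y + α • (z - α • v)) :
    (A + α) * (f y' - f u) + ‖z - α • v - u‖ ^ 2 / 2 ≤
      A * (f y - f u) + ‖z - u‖ ^ 2 / 2 +
        (inner ℝ (α • (v - gradient f x)) (u - z + α • gradient f x) +
          ‖α • (v - gradient f x)‖ ^ 2) := by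
  have hA' : 0 < A + α := by positivity
  have hy'x : y' = x - (α ^ 2 / (A + α)) • v := by
    refine smul_right_injective E hA'.ne' ?_
    simp only [smul_sub, smul_smul, mul_div_cancel₀ _ hA'.ne', hx, hy']
    module
  have hdescent := mul_le_mul_of_nonneg_left (map_sub_smul_le hf hL (x := x) (v := v)
    (η := α ^ 2 / (A + α)) (by positivity)
    (by rwa [← mul_div_assoc, div_le_one hA'])) hA'.le
  rw [← hy'x, show (A + α) * (f x - α ^ 2 / (A + α) * inner ℝ (gradient f x) v +
    α ^ 2 / (A + α) / 2 * ‖v‖ ^ 2) = (A + α) * f x - α ^ 2 * inner ℝ (gradient f x) v +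
      α ^ 2 / 2 * ‖v‖ ^ 2 by field_simp] at hdescent
  have hcouple := coupling_add_inner_gradient_le hc hA hα.le (hf x) hx u
  have hnoise : inner ℝ (α • (v - gradient f x)) (u - z + α • gradient f x) +
      ‖α • (v - gradient f x)‖ ^ 2 = α * inner ℝ v (u - z) -
        α * inner ℝ (gradient f x) (u - z) + α ^ 2 * ‖v‖ ^ 2 -
          α ^ 2 * inner ℝ (gradient f x) v := by
    rw [norm_smul, mul_pow, norm_sub_sq_real, Real.norm_eq_abs, sq_abs, real_inner_smul_left,
      inner_add_right, inner_smul_right, inner_sub_left, inner_sub_left,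
      real_inner_self_eq_norm_sq, real_inner_comm v]
    ring
  rw [hnoise, sq_norm_sub_smul_sub]
  linarith

end Smooth

/-! ### Moments of bounded and of independent random vectors -/

section Moments

variable {Ω : Type*} [MeasurableSpace Ω] {μ : Measure Ω}

lemma lintegral_exp_le_of_abs_le_one [IsProbabilityMeasure μ] {X : Ω → ℝ}
    (hX : AEStronglyMeasurable X μ) (hbound : ∀ ω, |X ω| ≤ 1) :
    ∫⁻ ω, ENNReal.ofReal (Real.exp (X ω)) ∂μ ≤
      ENNReal.ofReal (Real.exp (∫ ω, X ω ∂μ + ∫ ω, X ω ^ 2 ∂μ)) := by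
  have hXi : Integrable X μ := .of_bound hX 1 (.of_forall hbound)
  have hX2 : Integrable (fun ω => X ω ^ 2) μ := .of_bound (hX.pow 2) 1 (.of_forall fun ω => by
    rw [norm_pow, Real.norm_eq_abs]
    exact pow_le_one₀ (abs_nonneg _) (hbound ω))
  have hquad : Integrable (fun ω => 1 + X ω + X ω ^ 2) μ := ((integrable_const 1).add hXi).add hX2
  have hexp (ω : Ω) : Real.exp (X ω) ≤ 1 + X ω + X ω ^ 2 := by
    linarith [(abs_le.1 (Real.abs_exp_sub_one_sub_id_le (hbound ω))).2]
  calc ∫⁻ ω, ENNReal.ofReal (Real.exp (X ω)) ∂μ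
      ≤ ∫⁻ ω, ENNReal.ofReal (1 + X ω + X ω ^ 2) ∂μ :=
        lintegral_mono fun ω => ENNReal.ofReal_le_ofReal (hexp ω)
    _ = ENNReal.ofReal (∫ ω, (1 + X ω + X ω ^ 2) ∂μ) :=
        (ofReal_integral_eq_lintegral_ofReal hquad
          (.of_forall fun ω => (Real.exp_pos _).le.trans (hexp ω))).symm
    _ = ENNReal.ofReal (∫ ω, X ω ∂μ + ∫ ω, X ω ^ 2 ∂μ + 1) := by
        rw [integral_add (f := fun ω => 1 + X ω) ((integrable_const 1).add hXi) hX2,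
          integral_add (integrable_const 1) hXi, integral_const, probReal_univ, one_smul,
          add_assoc, add_comm]
    _ ≤ ENNReal.ofReal (Real.exp (∫ ω, X ω ∂μ + ∫ ω, X ω ^ 2 ∂μ)) :=
        ENNReal.ofReal_le_ofReal (Real.add_one_le_exp _)

lemma measureReal_lt_le_exp_sub_mul [IsFiniteMeasure μ] {W : Ω → ℝ} (hW : AEMeasurable W μ)
    {s t c : ℝ} (hs : 0 ≤ s)
    (hexp : ∫⁻ ω, ENNReal.ofReal (Real.exp (s * W ω)) ∂μ ≤ ENNReal.ofReal (Real.exp c)) :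
    μ.real {ω | t < W ω} ≤ Real.exp (c - s * t) := by
  have hmarkov : ENNReal.ofReal (Real.exp (s * t)) * μ {ω | t < W ω} ≤
      ENNReal.ofReal (Real.exp c) := by
    refine le_trans ?_ ((mul_meas_ge_le_lintegral₀ (hW.const_mul s).exp.ennreal_ofReal
      (ENNReal.ofReal (Real.exp (s * t)))).trans hexp)
    gcongr with ω
    exact fun hω => by gcongr
  have hreal := ENNReal.toReal_mono ENNReal.ofReal_ne_top hmarkov
  rw [ENNReal.toReal_mul, ENNReal.toReal_ofReal (Real.exp_pos _).le,
    ENNReal.toReal_ofReal (Real.exp_pos _).le] at hreal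
  rwa [Real.exp_sub, le_div_iff₀' (Real.exp_pos _)]

variable {E : Type*} [NormedAddCommGroup E] [InnerProductSpace ℝ E]

lemma abs_inner_add_sq_norm_le {e w : E} {b c : ℝ} (he : ‖e‖ ≤ b) (hw : ‖w‖ ≤ c) :
    |inner ℝ e w + ‖e‖ ^ 2| ≤ ‖e‖ * (b + c) :=
  calc |inner ℝ e w + ‖e‖ ^ 2| ≤ ‖e‖ * ‖w‖ + ‖e‖ * ‖e‖ := by
        refine (abs_add_le _ _).trans (add_le_add (abs_real_inner_le_norm e w) ?_)
        rw [abs_of_nonneg (sq_nonneg _), sq]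
    _ ≤ ‖e‖ * (b + c) := by rw [← mul_add, add_comm]; gcongr

lemma integral_sq_inner_add_sq_norm_le [IsFiniteMeasure μ] {V : Ω → E}
    (hV : AEStronglyMeasurable V μ) {w : E} {b c p : ℝ} (hb : ∀ ω, ‖V ω‖ ≤ b) (hw : ‖w‖ ≤ c)
    (hp : ∫ ω, ‖V ω‖ ^ 2 ∂μ ≤ p) :
    ∫ ω, (inner ℝ (V ω) w + ‖V ω‖ ^ 2) ^ 2 ∂μ ≤ (b + c) ^ 2 * p := by
  have hV2 := (MemLp.of_bound (p := 2) hV b (.of_forall hb)).integrable_norm_pow two_ne_zero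
  calc ∫ ω, (inner ℝ (V ω) w + ‖V ω‖ ^ 2) ^ 2 ∂μ
      ≤ ∫ ω, (b + c) ^ 2 * ‖V ω‖ ^ 2 ∂μ := by
        refine integral_mono_of_nonneg (.of_forall fun ω => sq_nonneg _) (hV2.const_mul _)
          (.of_forall fun ω => ?_)
        beta_reduce
        rw [← mul_pow, mul_comm (b + c)]
        exact sq_le_sq' (abs_le.1 (abs_inner_add_sq_norm_le (hb ω) hw)).1
          (abs_le.1 (abs_inner_add_sq_norm_le (hb ω) hw)).2
    _ ≤ (b + c) ^ 2 * p := by rw [integral_const_mul]; gcongr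

variable [CompleteSpace E]

lemma integral_inner_add_sq_norm_le [IsFiniteMeasure μ] {V : Ω → E}
    (hV : AEStronglyMeasurable V μ) {w : E} {b c e p : ℝ} (hb : ∀ ω, ‖V ω‖ ≤ b) (hw : ‖w‖ ≤ c)
    (hp : ∫ ω, ‖V ω‖ ^ 2 ∂μ ≤ p) (he : ‖∫ ω, V ω ∂μ‖ ≤ e) :
    ∫ ω, (inner ℝ (V ω) w + ‖V ω‖ ^ 2) ∂μ ≤ e * c + p := by
  have hVi : Integrable V μ := .of_bound hV b (.of_forall hb)
  have hV2 := (MemLp.of_bound (p := 2) hV b (.of_forall hb)).integrable_norm_pow two_ne_zero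
  simp only [real_inner_comm w]
  rw [integral_add (hVi.const_inner w) hV2, integral_inner hVi, real_inner_comm]
  exact add_le_add ((real_inner_le_norm _ _).trans
    (mul_le_mul he hw (norm_nonneg _) ((norm_nonneg _).trans he))) hp

lemma lintegral_exp_inner_add_sq_norm_le [IsProbabilityMeasure μ] {V : Ω → E}
    (hV : AEStronglyMeasurable V μ) {w : E} {b c e p s : ℝ} (hs : 0 ≤ s) (hb : ∀ ω, ‖V ω‖ ≤ b)
    (hw : ‖w‖ ≤ c) (hp : ∫ ω, ‖V ω‖ ^ 2 ∂μ ≤ p) (he : ‖∫ ω, V ω ∂μ‖ ≤ e)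
    (hsb : s * (b * (b + c)) ≤ 1) :
    ∫⁻ ω, ENNReal.ofReal (Real.exp (s * (inner ℝ (V ω) w + ‖V ω‖ ^ 2))) ∂μ ≤
      ENNReal.ofReal (Real.exp (s * (e * c + p) + s ^ 2 * ((b + c) ^ 2 * p))) := by
  have hbound (ω : Ω) : |s * (inner ℝ (V ω) w + ‖V ω‖ ^ 2)| ≤ 1 := by
    have hbc : 0 ≤ b + c :=
      add_nonneg ((norm_nonneg _).trans (hb ω)) ((norm_nonneg _).trans hw)
    rw [abs_mul, abs_of_nonneg hs]
    refine le_trans ?_ hsb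
    gcongr
    exact (abs_inner_add_sq_norm_le (hb ω) hw).trans (by gcongr; exact hb ω)
  refine (lintegral_exp_le_of_abs_le_one
    (((hV.inner aestronglyMeasurable_const).add (hV.norm.pow 2)).const_mul s) hbound).trans ?_
  simp only [Pi.add_apply, Pi.pow_apply, mul_pow, integral_const_mul]
  gcongr
  · exact integral_inner_add_sq_norm_le hV hb hw hp he
  · exact integral_sq_inner_add_sq_norm_le hV hb hw hp

lemma integral_inner_eq_zero_of_indepFun [MeasurableSpace E] [BorelSpace E] {X Y : Ω → E}
    (hX : Integrable X μ) (hY : Integrable Y μ) (hX0 : ∫ ω, X ω ∂μ = 0)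
    (hXY : IndepFun X Y μ) : ∫ ω, inner ℝ (X ω) (Y ω) ∂μ = 0 := by
  have hbilin := hXY.integral_bilin hX hY (innerSL ℝ)
  rwa [hX0, map_zero, zero_apply] at hbilin

lemma integral_norm_sq_sum_of_indepFun [MeasurableSpace E] [BorelSpace E] [IsFiniteMeasure μ]
    {ι : Type*} (t : Finset ι) {Y : ι → Ω → E} (hY : ∀ i, MemLp (Y i) 2 μ)
    (hmean : ∀ i, ∫ ω, Y i ω ∂μ = 0) (hind : Pairwise fun i j => IndepFun (Y i) (Y j) μ) :
    ∫ ω, ‖∑ i ∈ t, Y i ω‖ ^ 2 ∂μ = ∑ i ∈ t, ∫ ω, ‖Y i ω‖ ^ 2 ∂μ := by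
  classical
  have hint (i j : ι) : Integrable (fun ω => inner ℝ (Y i ω) (Y j ω)) μ := by
    refine Integrable.mono' (((hY i).integrable_norm_pow two_ne_zero).add
      ((hY j).integrable_norm_pow two_ne_zero)) ((hY i).1.inner (hY j).1) (.of_forall fun ω => ?_)
    have := abs_real_inner_le_norm (Y i ω) (Y j ω)
    simp only [Pi.add_apply, Real.norm_eq_abs]
    nlinarith [sq_nonneg (‖Y i ω‖ - ‖Y j ω‖), sq_nonneg ‖Y i ω‖, sq_nonneg ‖Y j ω‖]
  have hcov (i j : ι) : ∫ ω, inner ℝ (Y i ω) (Y j ω) ∂μ =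
      if i = j then ∫ ω, ‖Y i ω‖ ^ 2 ∂μ else 0 := by
    split_ifs with h
    · simp only [h, real_inner_self_eq_norm_sq]
    · exact integral_inner_eq_zero_of_indepFun ((hY i).integrable one_le_two)
        ((hY j).integrable one_le_two) (hmean i) (hind h)
  simp only [← real_inner_self_eq_norm_sq, sum_inner, inner_sum]
  rw [integral_finsetSum _ fun i _ => integrable_finsetSum _ fun j _ => hint j i]
  refine Finset.sum_congr rfl fun i hi => ?_
  rw [integral_finsetSum _ fun j _ => hint j i]
  simp only [hcov, real_inner_self_eq_norm_sq]
  rw [Finset.sum_ite_eq', if_pos hi]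

end Moments

/-! ### Recursions driven by independent inputs -/

section Driven

noncomputable section

variable {S V : Type*}

/-- The recursion `X_{k+1} = F_k(X_k, u_k)` from `X_0 = x₀`, driven by the inputs `u`. -/
def driven (F : ℕ → S → V → S) (x₀ : S) (u : ℕ → V) : ℕ → S
  | 0 => x₀
  | k + 1 => F k (driven F x₀ u k) (u k)

end

variable {S V : Type*} {F : ℕ → S → V → S} {x₀ : S}
  {Ω : Type*} {v : ℕ → Ω → V} [MeasurableSpace S] [MeasurableSpace V]

lemma measurable_driven (hF : ∀ k, Measurable (Function.uncurry (F k))) (k : ℕ) :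
    Measurable[⨆ j ∈ Set.Iio k, MeasurableSpace.comap (v j) inferInstance]
      fun ω => driven F x₀ (fun j => v j ω) k := by
  induction k with
  | zero => exact measurable_const
  | succ k ih =>
    have hpast := ih.mono (biSup_mono fun j hj => hj.trans k.lt_succ_self) le_rfl
    have hinput : Measurable[⨆ j ∈ Set.Iio (k + 1), MeasurableSpace.comap (v j) inferInstance]
        (v k) := Measurable.of_comap_le (le_iSup₂_of_le (f := fun j (_ : j ∈ Set.Iio (k + 1)) =>
          MeasurableSpace.comap (v j) inferInstance) k k.lt_succ_self le_rfl)
    exact (hF k).comp (hpast.prodMk hinput)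

variable [MeasurableSpace Ω] {μ : Measure Ω}

lemma measurable_driven_of_measurable (hF : ∀ k, Measurable (Function.uncurry (F k)))
    (hv : ∀ k, Measurable (v k)) (k : ℕ) :
    Measurable fun ω => driven F x₀ (fun j => v j ω) k :=
  (measurable_driven hF k).mono (iSup₂_le fun j _ => (hv j).comap_le) le_rfl

lemma indepFun_driven (hF : ∀ k, Measurable (Function.uncurry (F k)))
    (hv : ∀ k, Measurable (v k)) (hind : iIndepFun v μ) (k : ℕ) :
    IndepFun (fun ω => driven F x₀ (fun j => v j ω) k) (v k) μ := by
  have hpast := indep_iSup_of_disjoint (fun j => (hv j).comap_le) hind.iIndep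
    (Set.disjoint_singleton_right.2 (lt_irrefl k) : Disjoint (Set.Iio k) {k})
  rw [IndepFun_iff_Indep]
  exact indep_of_indep_of_le_left
    (indep_of_indep_of_le_right hpast (le_biSup (f := fun j =>
      MeasurableSpace.comap (v j) inferInstance) (Set.mem_singleton k)))
    (measurable_driven hF k).comap_le

lemma lintegral_comp_prodMk_of_indepFun [IsProbabilityMeasure μ] {X : Ω → S} {Y : Ω → V}
    (hX : AEMeasurable X μ) (hY : AEMeasurable Y μ) (hXY : IndepFun X Y μ)
    {Φ : S × V → ENNReal} (hΦ : Measurable Φ) :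
    ∫⁻ ω, Φ (X ω, Y ω) ∂μ = ∫⁻ ω, ∫⁻ ω', Φ (X ω, Y ω') ∂μ ∂μ := by
  have := Measure.isProbabilityMeasure_map (μ := μ) hX
  have := Measure.isProbabilityMeasure_map (μ := μ) hY
  rw [← lintegral_map' hΦ.aemeasurable (hX.prodMk hY),
    (indepFun_iff_map_prod_eq_prod_map_map hX hY).1 hXY,
    lintegral_prod _ hΦ.aemeasurable,
    lintegral_map' hΦ.lintegral_prod_right'.aemeasurable hX]
  refine lintegral_congr fun ω => ?_
  exact lintegral_map' (hΦ.comp measurable_prodMk_left).aemeasurable hY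

lemma lintegral_driven_le [IsProbabilityMeasure μ]
    (hF : ∀ k, Measurable (Function.uncurry (F k))) (hv : ∀ k, Measurable (v k))
    (hind : iIndepFun v μ) {φ : S → ENNReal} (hφ : Measurable φ) {c : ENNReal}
    (hdrift : ∀ k ω, ∫⁻ ω', φ (F k (driven F x₀ (fun j => v j ω) k) (v k ω')) ∂μ ≤
      c * φ (driven F x₀ (fun j => v j ω) k)) (k : ℕ) :
    ∫⁻ ω, φ (driven F x₀ (fun j => v j ω) k) ∂μ ≤ c ^ k * φ x₀ := by
  induction k with
  | zero => simp [driven]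
  | succ k ih =>
    have hX := measurable_driven_of_measurable (x₀ := x₀) hF hv k
    calc ∫⁻ ω, φ (driven F x₀ (fun j => v j ω) (k + 1)) ∂μ
        = ∫⁻ ω, ∫⁻ ω', φ (F k (driven F x₀ (fun j => v j ω) k) (v k ω')) ∂μ ∂μ :=
          lintegral_comp_prodMk_of_indepFun hX.aemeasurable (hv k).aemeasurable
            (indepFun_driven hF hv hind k) (hφ.comp (hF k))
      _ ≤ ∫⁻ ω, c * φ (driven F x₀ (fun j => v j ω) k) ∂μ := lintegral_mono (hdrift k)
      _ ≤ c * (c ^ k * φ x₀) := by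
          rw [lintegral_const_mul (f := fun ω => φ (driven F x₀ (fun j => v j ω) k)) _ (hφ.comp hX)]
          gcongr
      _ = c ^ (k + 1) * φ x₀ := by ring

lemma iIndepFun_pi_of_iIndepFun_prod [IsProbabilityMeasure μ] {ι κ : Type*}
    {ξ : ι → κ → Ω → V} (hξ : ∀ i j, Measurable (ξ i j))
    (hind : iIndepFun (fun p : ι × κ => ξ p.1 p.2) μ) :
    iIndepFun (fun i ω j => ξ i j ω) μ := by
  have hlaw := hind.map_fun_eq_infinitePi_map fun p : ι × κ => hξ p.1 p.2
  have (i : ι) (j : κ) := Measure.isProbabilityMeasure_map (μ := μ) (hξ i j).aemeasurable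
  have hrow (i : ι) : μ.map (fun ω j => ξ i j ω) =
      Measure.infinitePi fun j => μ.map (ξ i j) :=
    (hind.precomp (g := Prod.mk i) (Prod.mk_right_injective i)).map_fun_eq_infinitePi_map (hξ i)
  rw [iIndepFun_iff_map_fun_eq_infinitePi_map fun i => measurable_pi_lambda _ (hξ i)]
  simp only [hrow]
  rw [← Measure.infinitePi_map_curry, ← hlaw, Measure.map_map (by fun_prop)
    (measurable_pi_lambda _ fun p : ι × κ => hξ p.1 p.2)]
  rfl

end Driven

/-! ### Clipping -/

section Clip

variable {n : ℕ} {v d : EuclideanSpace ℝ (Fin n)} {l : ℝ}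

lemma clip_of_norm_le (h : ‖v‖ ≤ l) : clip v l = v := by
  rcases eq_or_ne v 0 with rfl | hv
  · exact smul_zero _
  · rw [clip, min_eq_left ((one_le_div (norm_pos_iff.2 hv)).2 h), one_smul]

lemma clip_of_lt_norm (hl : 0 ≤ l) (h : l < ‖v‖) : clip v l = (l / ‖v‖) • v := by
  rw [clip, min_eq_right ((div_le_one (hl.trans_lt h)).2 h.le)]

lemma norm_clip_le (v : EuclideanSpace ℝ (Fin n)) (hl : 0 ≤ l) : ‖clip v l‖ ≤ l := by
  rcases le_or_gt ‖v‖ l with h | h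
  · rwa [clip_of_norm_le h]
  · have hv : 0 < ‖v‖ := hl.trans_lt h
    rw [clip_of_lt_norm hl h, norm_smul, Real.norm_of_nonneg (by positivity),
      div_mul_cancel₀ _ hv.ne']

lemma norm_clip_sub_le (hd : ‖d‖ ≤ l) : ‖clip v l - d‖ ≤ ‖v - d‖ := by
  have hl : 0 ≤ l := (norm_nonneg d).trans hd
  rcases le_or_gt ‖v‖ l with h | h
  · rw [clip_of_norm_le h]
  · have hv : 0 < ‖v‖ := hl.trans_lt h
    rw [clip_of_lt_norm hl h]
    set c := l / ‖v‖
    have hcv : c * ‖v‖ = l := div_mul_cancel₀ _ hv.ne'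
    have hc1 : c ≤ 1 := (div_le_one hv).2 h.le
    have hinner : inner ℝ v d ≤ c * ‖v‖ ^ 2 := by
      nlinarith [real_inner_le_norm v d, mul_le_mul_of_nonneg_left hd hv.le]
    refine le_of_sq_le_sq ?_ (norm_nonneg _)
    rw [norm_sub_sq_real, norm_sub_sq_real, norm_smul, real_inner_smul_left, mul_pow,
      Real.norm_eq_abs, sq_abs]
    nlinarith [mul_nonneg (sub_nonneg.2 hc1) (sub_nonneg.2 hinner),
      mul_nonneg (sq_nonneg (1 - c)) (sq_nonneg ‖v‖)]

lemma norm_clip_sub_self_le (hl : 0 < l) (hd : ‖d‖ ≤ l / 2) :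
    ‖clip v l - v‖ ≤ ‖v - d‖ ^ 2 / (2 * l) := by
  rcases le_or_gt ‖v‖ l with h | h
  · rw [clip_of_norm_le h, sub_self, norm_zero]
    positivity
  · have hv : 0 < ‖v‖ := hl.trans h
    have hscale : clip v l - v = -((1 - l / ‖v‖) • v) := by
      rw [clip_of_lt_norm hl.le h, sub_smul, one_smul, neg_sub]
    have hexcess : ‖v‖ - ‖d‖ ≤ ‖v - d‖ := norm_sub_norm_le v d
    rw [hscale, norm_neg, norm_smul,
      Real.norm_of_nonneg (sub_nonneg.2 ((div_le_one hv).2 h.le)), sub_mul,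
      div_mul_cancel₀ _ hv.ne', one_mul, le_div_iff₀ (by positivity)]
    nlinarith [sq_nonneg (‖v - d‖ - l)]

end Clip

/-! ### Weights and averages -/

section Weights

variable {a L : ℝ}

lemma bigA_eq (a L : ℝ) (k : ℕ) : bigA a L k = (k : ℝ) * (k + 3) / (4 * a * L) := by
  induction k with
  | zero => simp [bigA]
  | succ k ih =>
    rw [bigA, ih, alpha]
    rcases eq_or_ne (a * L) 0 with h | h
    · simp [mul_assoc, h]
    · have ha := left_ne_zero_of_mul h
      have hL := right_ne_zero_of_mul h
      push_cast
      field_simp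
      ring

lemma alpha_succ_pos (ha : 0 < a) (hL : 0 < L) (k : ℕ) : 0 < alpha a L (k + 1) := by
  rw [alpha]; positivity

lemma bigA_nonneg (ha : 0 < a) (hL : 0 < L) (k : ℕ) : 0 ≤ bigA a L k := by
  rw [bigA_eq]; positivity

lemma bigA_succ_pos (ha : 0 < a) (hL : 0 < L) (k : ℕ) : 0 < bigA a L (k + 1) := by
  rw [bigA_eq]; positivity

lemma mul_sq_alpha_le_bigA (ha : 0 < a) (hL : 0 < L) (k : ℕ) :
    a * L * alpha a L (k + 1) ^ 2 ≤ bigA a L (k + 1) := by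
  rw [bigA_eq, alpha, div_pow, ← mul_div_assoc, div_le_div_iff₀ (by positivity) (by positivity)]
  push_cast
  have : 0 ≤ (a * L) ^ 2 * (k : ℝ) := by positivity
  nlinarith

lemma mul_sq_alpha_le_mul_bigA (ha : 0 < a) (hL : 0 < L) {k : ℕ} (hk : 1 ≤ k) :
    4 * a * (L * alpha a L (k + 1) ^ 2) ≤ 9 * bigA a L k := by
  have hk' : (1 : ℝ) ≤ k := by exact_mod_cast hk
  rw [bigA_eq, alpha]
  field_simp
  nlinarith

variable {n : ℕ}

noncomputable section

/-- The weighted mean `(A_k y + α_{k+1} z) / A_{k+1}`, which gives `x^{k+1}` at `z = z^k` and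
`y^{k+1}` at `z = z^{k+1}`. -/
def average (a L : ℝ) (k : ℕ) (y z : EuclideanSpace ℝ (Fin n)) : EuclideanSpace ℝ (Fin n) :=
  (1 / bigA a L (k + 1)) • (bigA a L k • y + alpha a L (k + 1) • z)

/-- The point `x^{k+1}` at which the method samples the gradient from the state `(y^k, z^k)`. -/
def queryPoint (a L : ℝ) (k : ℕ) (S : State n) : EuclideanSpace ℝ (Fin n) :=
  average a L k S.y S.z

end

lemma bigA_succ_smul_average (ha : 0 < a) (hL : 0 < L) (k : ℕ)
    (y z : EuclideanSpace ℝ (Fin n)) :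
    bigA a L (k + 1) • average a L k y z = bigA a L k • y + alpha a L (k + 1) • z := by
  rw [average, smul_smul, mul_one_div_cancel (bigA_succ_pos ha hL k).ne', one_smul]

lemma average_mem {s : Set (EuclideanSpace ℝ (Fin n))} (hs : Convex ℝ s) (ha : 0 < a)
    (hL : 0 < L) (k : ℕ) {y z : EuclideanSpace ℝ (Fin n)} (hy : y ∈ s) (hz : z ∈ s) :
    average a L k y z ∈ s := by
  have hA := bigA_succ_pos ha hL k
  rw [average, smul_add, smul_smul, smul_smul]
  refine hs hy hz (mul_nonneg (by positivity) (bigA_nonneg ha hL k))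
    (mul_nonneg (by positivity) (alpha_succ_pos ha hL k).le) ?_
  rw [← mul_add, ← bigA, one_div_mul_cancel hA.ne']

lemma mul_norm_average_sub_le (ha : 0 < a) (hL : 0 < L) (k : ℕ)
    (y z : EuclideanSpace ℝ (Fin n)) :
    alpha a L (k + 1) * (L * ‖average a L k y z - y‖) ≤ ‖z - y‖ / a := by
  have hA := bigA_succ_pos ha hL k
  have hα := alpha_succ_pos ha hL k
  have hsub : bigA a L (k + 1) • (average a L k y z - y) = alpha a L (k + 1) • (z - y) := by
    rw [smul_sub, bigA_succ_smul_average ha hL, bigA]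
    module
  have hnorm : bigA a L (k + 1) * ‖average a L k y z - y‖ = alpha a L (k + 1) * ‖z - y‖ := by
    simpa only [norm_smul, Real.norm_of_nonneg hA.le, Real.norm_of_nonneg hα.le] using
      congrArg norm hsub
  rw [le_div_iff₀ ha]
  refine le_of_mul_le_mul_left ?_ hA
  calc bigA a L (k + 1) * (alpha a L (k + 1) * (L * ‖average a L k y z - y‖) * a)
      = alpha a L (k + 1) * L * a * (bigA a L (k + 1) * ‖average a L k y z - y‖) := by ring
    _ = a * L * alpha a L (k + 1) ^ 2 * ‖z - y‖ := by rw [hnorm]; ring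
    _ ≤ bigA a L (k + 1) * ‖z - y‖ := by gcongr; exact mul_sq_alpha_le_bigA ha hL k

end Weights

/-! ### The potential along a run -/

section Potential

noncomputable section

variable {n : ℕ} {Ξ : Type*} (f : EuclideanSpace ℝ (Fin n) → ℝ)
  (g : EuclideanSpace ℝ (Fin n) → Ξ → EuclideanSpace ℝ (Fin n))
  (xstar x0 : EuclideanSpace ℝ (Fin n)) (a L B T : ℝ)

/-- The potential `A_k (f(y^k) - f(x^*)) + ‖z^k - x^*‖² / 2` of accelerated gradient methods. -/
def potential (k : ℕ) (S : State n) : ℝ :=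
  bigA a L k * (f S.y - f xstar) + ‖S.z - xstar‖ ^ 2 / 2

/-- The scaled error `α_{k+1} (clip g^{k+1} - ∇f(x))` of the clipped gradient, for a mini-batch of
size `m` at the point `x`. -/
def scaledError (k m : ℕ) (x : EuclideanSpace ℝ (Fin n)) (s : ℕ → Ξ) :
    EuclideanSpace ℝ (Fin n) :=
  alpha a L (k + 1) • (clip (miniBatch g m s x) (B / alpha a L (k + 1)) - gradient f x)

/-- The bound on the increase of the potential in iteration `k` that the error of the clipped
gradient at `x^{k+1}` causes. -/
def noise (k m : ℕ) (S : State n) (s : ℕ → Ξ) : ℝ :=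
  inner ℝ (scaledError f g a L B k m (queryPoint a L k S) s)
    (xstar - S.z + alpha a L (k + 1) • gradient f (queryPoint a L k S)) +
  ‖scaledError f g a L B k m (queryPoint a L k S) s‖ ^ 2

/-- One iteration of the method that also accumulates the noise in the second component, which is
frozen once it exceeds `T`. -/
def trackedStep (k m : ℕ) (p : State n × ℝ) (s : ℕ → Ξ) : State n × ℝ :=
  (step g a L B k m s p.1, p.2 + if p.2 ≤ T then noise f g xstar a L B k m p.1 s else 0)

/-- The run of the method from `x0` together with its accumulated noise, stopped above `T`. -/
def tracked (m : ℕ → ℕ) (s : ℕ → ℕ → Ξ) : ℕ → State n × ℝ :=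
  driven (fun k => trackedStep f g xstar a L B T k (m k)) (⟨x0, x0⟩, 0) s

end

variable {n : ℕ} {Ξ : Type*} {f : EuclideanSpace ℝ (Fin n) → ℝ}
  {g : EuclideanSpace ℝ (Fin n) → Ξ → EuclideanSpace ℝ (Fin n)}
  {xstar x0 : EuclideanSpace ℝ (Fin n)} {a L B T D : ℝ} {m : ℕ → ℕ} {s : ℕ → ℕ → Ξ} {k : ℕ}

lemma fst_tracked (k : ℕ) :
    (tracked f g xstar x0 a L B T m s k).1 = run g x0 a L B m s k := by
  induction k with
  | zero => rfl
  | succ k ih => exact congrArg (step g a L B k (m k) (s k)) ih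

lemma snd_tracked_le_of_succ (h : (tracked f g xstar x0 a L B T m s (k + 1)).2 ≤ T) :
    (tracked f g xstar x0 a L B T m s k).2 ≤ T := by
  by_contra hk
  refine hk (le_of_eq_of_le ?_ h)
  simp only [tracked, driven, trackedStep] at hk ⊢
  rw [if_neg hk, add_zero]

lemma potential_step_le (hc : ConvexOn ℝ Set.univ f) (hs : IsLSmooth f L) (hL : 0 < L)
    (ha : 1 ≤ a) (k m : ℕ) (S : State n) (s : ℕ → Ξ) :
    potential f xstar a L (k + 1) (step g a L B k m s S) ≤
      potential f xstar a L k S + noise f g xstar a L B k m S s := by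
  have ha0 : 0 < a := one_pos.trans_le ha
  have hLα : L * alpha a L (k + 1) ^ 2 ≤ bigA a L k + alpha a L (k + 1) := by
    refine le_trans ?_ (mul_sq_alpha_le_bigA ha0 hL k)
    rw [mul_assoc]
    exact le_mul_of_one_le_left (by positivity) ha
  exact coupling_step_le hc hs.differentiable hs.gradient_lipschitz (bigA_nonneg ha0 hL k)
    (alpha_succ_pos ha0 hL k) hLα _ xstar (bigA_succ_smul_average ha0 hL k S.y S.z)
    (bigA_succ_smul_average ha0 hL k S.y (step g a L B k m s S).z)

lemma potential_tracked_le (hc : ConvexOn ℝ Set.univ f) (hs : IsLSmooth f L) (hL : 0 < L)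
    (ha : 1 ≤ a) (hk : (tracked f g xstar x0 a L B T m s k).2 ≤ T) :
    potential f xstar a L k (tracked f g xstar x0 a L B T m s k).1 ≤
      ‖x0 - xstar‖ ^ 2 / 2 + (tracked f g xstar x0 a L B T m s k).2 := by
  induction k with
  | zero => simp [potential, tracked, driven, bigA]
  | succ k ih =>
    have hk' := snd_tracked_le_of_succ hk
    have hstep := potential_step_le (g := g) (xstar := xstar) (B := B) hc hs hL ha k (m k)
      (tracked f g xstar x0 a L B T m s k).1 (s k)
    have hsnd : (tracked f g xstar x0 a L B T m s (k + 1)).2 =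
        (tracked f g xstar x0 a L B T m s k).2 + noise f g xstar a L B k (m k)
          (tracked f g xstar x0 a L B T m s k).1 (s k) :=
      congrArg ((tracked f g xstar x0 a L B T m s k).2 + ·) (if_pos hk')
    rw [hsnd, ← add_assoc]
    exact hstep.trans (by gcongr; exact ih hk')

lemma norm_z_sub_le_of_potential_le (ha : 0 < a) (hL : 0 < L) (hmin : IsMinOn f Set.univ xstar)
    (hD : 0 ≤ D) {S : State n} (hS : potential f xstar a L k S ≤ D ^ 2 / 2) :
    ‖S.z - xstar‖ ≤ D := by
  have hgap : 0 ≤ bigA a L k * (f S.y - f xstar) :=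
    mul_nonneg (bigA_nonneg ha hL k) (sub_nonneg.2 (hmin (Set.mem_univ _)))
  refine le_of_sq_le_sq ?_ hD
  rw [potential] at hS
  linarith

lemma norm_y_sub_le_of_snd_tracked_le (hc : ConvexOn ℝ Set.univ f) (hs : IsLSmooth f L)
    (hL : 0 < L) (ha : 1 ≤ a) (hmin : IsMinOn f Set.univ xstar) (hD : 0 ≤ D)
    (hT : 0 ≤ T) (hDT : ‖x0 - xstar‖ ^ 2 + 2 * T ≤ D ^ 2)
    (hk : (tracked f g xstar x0 a L B T m s k).2 ≤ T) :
    ‖(tracked f g xstar x0 a L B T m s k).1.y - xstar‖ ≤ D := by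
  have ha0 : 0 < a := one_pos.trans_le ha
  induction k with
  | zero => exact le_of_sq_le_sq (by simpa only [tracked, driven] using by linarith) hD
  | succ k ih =>
    have hz := norm_z_sub_le_of_potential_le ha0 hL hmin hD
      ((potential_tracked_le hc hs hL ha hk).trans (by linarith))
    rw [← mem_closedBall_iff_norm] at hz ⊢
    exact average_mem (convex_closedBall xstar D) ha0 hL k
      (mem_closedBall_iff_norm.2 (ih (snd_tracked_le_of_succ hk))) hz

end Potential

/-! ### Size of the gradients along a run -/

section Gradient

variable {n : ℕ} {f : EuclideanSpace ℝ (Fin n) → ℝ} {xstar : EuclideanSpace ℝ (Fin n)}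
  {a L D l : ℝ} {k : ℕ}

lemma alpha_mul_norm_gradient_average_sub_le (hs : IsLSmooth f L) (hL : 0 < L) (ha : 0 < a)
    (k : ℕ) (y z : EuclideanSpace ℝ (Fin n)) :
    alpha a L (k + 1) * ‖gradient f (average a L k y z) - gradient f y‖ ≤ ‖z - y‖ / a :=
  (mul_le_mul_of_nonneg_left (hs.gradient_lipschitz _ _) (alpha_succ_pos ha hL k).le).trans
    (mul_norm_average_sub_le ha hL k y z)

lemma alpha_mul_norm_gradient_le_of_gap_le (hs : IsLSmooth f L) (hL : 0 < L) (ha : 0 < a)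
    (hmin : IsMinOn f Set.univ xstar) (hD : 0 ≤ D) (hk : 1 ≤ k) {y : EuclideanSpace ℝ (Fin n)}
    (hy : bigA a L k * (f y - f xstar) ≤ D ^ 2 / 2) :
    alpha a L (k + 1) * ‖gradient f y‖ ≤ D * (3 / (2 * √a)) := by
  refine le_of_sq_le_sq ?_ (by positivity)
  have hgap : 0 ≤ f y - f xstar := sub_nonneg.2 (hmin (Set.mem_univ _))
  have hsq : 4 * a * (alpha a L (k + 1) * ‖gradient f y‖) ^ 2 ≤ 9 * D ^ 2 :=
    calc 4 * a * (alpha a L (k + 1) * ‖gradient f y‖) ^ 2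
        = 4 * a * alpha a L (k + 1) ^ 2 * ‖gradient f y‖ ^ 2 := by ring
      _ ≤ 4 * a * alpha a L (k + 1) ^ 2 * (2 * L * (f y - f xstar)) := by
          gcongr
          exact sq_norm_gradient_le hL hs.differentiable hs.gradient_lipschitz hmin y
      _ = 4 * a * (L * alpha a L (k + 1) ^ 2) * (2 * (f y - f xstar)) := by ring
      _ ≤ 9 * bigA a L k * (2 * (f y - f xstar)) :=
          mul_le_mul_of_nonneg_right (mul_sq_alpha_le_mul_bigA ha hL hk) (by positivity)
      _ ≤ 9 * D ^ 2 := by linarith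
  rw [mul_pow D, div_pow, mul_pow 2, Real.sq_sqrt ha.le, mul_div_assoc',
    le_div_iff₀ (by positivity)]
  linarith

lemma alpha_mul_norm_gradient_queryPoint_le (hs : IsLSmooth f L) (hL : 0 < L) (ha : 0 < a)
    (hmin : IsMinOn f Set.univ xstar) {S : State n} (hy : ‖S.y - xstar‖ ≤ D)
    (hz : ‖S.z - xstar‖ ≤ D) (hgap : bigA a L k * (f S.y - f xstar) ≤ D ^ 2 / 2) :
    alpha a L (k + 1) * ‖gradient f (queryPoint a L k S)‖ ≤ D * (2 / a + 3 / (2 * √a)) := by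
  have hD : 0 ≤ D := (norm_nonneg _).trans hy
  have hα := alpha_succ_pos ha hL k
  rcases k.eq_zero_or_pos with rfl | hk
  · have hx : ‖queryPoint a L 0 S - xstar‖ ≤ D := mem_closedBall_iff_norm.1 <|
      average_mem (convex_closedBall xstar D) ha hL 0 (mem_closedBall_iff_norm.2 hy)
        (mem_closedBall_iff_norm.2 hz)
    have hgrad := hs.gradient_lipschitz (queryPoint a L 0 S) xstar
    rw [gradient_eq_zero_of_isMinOn hmin, sub_zero] at hgrad
    calc alpha a L 1 * ‖gradient f (queryPoint a L 0 S)‖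
        ≤ alpha a L 1 * (L * D) := by gcongr; exact hgrad.trans (by gcongr)
      _ = D * (1 / a) := by rw [alpha]; field_simp; norm_num
      _ ≤ D * (2 / a + 3 / (2 * √a)) := by
          gcongr
          exact le_add_of_le_of_nonneg (by gcongr; norm_num) (by positivity)
  · have hzy : ‖S.z - S.y‖ ≤ 2 * D := by
      rw [← sub_sub_sub_cancel_right _ _ xstar]
      linarith [norm_sub_le (S.z - xstar) (S.y - xstar)]
    calc alpha a L (k + 1) * ‖gradient f (queryPoint a L k S)‖
        ≤ alpha a L (k + 1) * (‖gradient f (queryPoint a L k S) - gradient f S.y‖ +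
            ‖gradient f S.y‖) := by gcongr; exact norm_le_norm_sub_add _ _
      _ ≤ 2 * D / a + D * (3 / (2 * √a)) := by
          rw [mul_add]
          refine add_le_add ?_ (alpha_mul_norm_gradient_le_of_gap_le hs hL ha hmin hD hk hgap)
          exact (alpha_mul_norm_gradient_average_sub_le hs hL ha k S.y S.z).trans (by gcongr)
      _ = D * (2 / a + 3 / (2 * √a)) := by ring

-- The lower bound on `√a` is the larger root of `u² = 24 l u + 72 l`.
lemma two_div_add_le_of_le (hl : 0 < l) (ha : 36 * (2 * l + √(4 * l ^ 2 + 2 * l)) ^ 2 ≤ a) :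
    2 / a + 3 / (2 * √a) ≤ 1 / (16 * l) := by
  set q := √(4 * l ^ 2 + 2 * l)
  have : 0 ≤ q := Real.sqrt_nonneg _
  have hq : q ^ 2 = 4 * l ^ 2 + 2 * l := Real.sq_sqrt (by positivity)
  have ha0 : 0 < a := lt_of_lt_of_le (by positivity) ha
  have : 0 < √a := Real.sqrt_pos.2 ha0
  have hu : √a ^ 2 = a := Real.sq_sqrt ha0.le
  have hroot : 6 * (2 * l + q) ≤ √a := Real.le_sqrt_of_sq_le (by linarith [mul_pow 6 (2 * l + q) 2])
  have hquad : 24 * l * √a + 72 * l ≤ a := by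
    nlinarith [mul_self_le_mul_self (by positivity : 0 ≤ 6 * q)
      (by linarith : 6 * q ≤ √a - 12 * l)]
  have hfrac : 3 / (2 * √a) = 3 * √a / (2 * a) := by
    rw [div_eq_div_iff (by positivity) (by positivity)]
    linear_combination -6 * hu
  calc 2 / a + 3 / (2 * √a) = (4 + 3 * √a) / (2 * a) := by rw [hfrac]; field_simp; ring
    _ ≤ 1 / (16 * l) := by
      rw [div_le_div_iff₀ (by positivity) (by positivity)]
      linarith

end Gradient

/-! ### Mini-batches and the error of the clipped gradient -/

lemma measurable_clip {n : ℕ} (l : ℝ) :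
    Measurable fun v : EuclideanSpace ℝ (Fin n) => clip v l := by
  unfold clip
  fun_prop

section Sampling

variable {n : ℕ} {Ξ : Type*} {f : EuclideanSpace ℝ (Fin n) → ℝ}
  {g : EuclideanSpace ℝ (Fin n) → Ξ → EuclideanSpace ℝ (Fin n)} {σ a L B D l p : ℝ} {k m : ℕ}
  {x xstar : EuclideanSpace ℝ (Fin n)}

lemma miniBatch_sub (hm : 0 < m) (s : ℕ → Ξ) (x d : EuclideanSpace ℝ (Fin n)) :
    miniBatch g m s x - d = miniBatch (fun x t => g x t - d) m s x := by
  have hm' : (m : ℝ) ≠ 0 := by positivity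
  rw [miniBatch, miniBatch, Finset.sum_sub_distrib, Finset.sum_const, Finset.card_range, smul_sub,
    ← Nat.cast_smul_eq_nsmul ℝ, smul_smul, one_div_mul_cancel hm', one_smul]

lemma norm_scaledError_le (hα : 0 < alpha a L (k + 1)) (hB : 0 ≤ B)
    (hx : alpha a L (k + 1) * ‖gradient f x‖ ≤ B / 2) (s : ℕ → Ξ) :
    ‖scaledError f g a L B k m x s‖ ≤ 3 * B / 2 := by
  rw [scaledError, norm_smul, Real.norm_of_nonneg hα.le]
  calc alpha a L (k + 1) * ‖clip (miniBatch g m s x) (B / alpha a L (k + 1)) - gradient f x‖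
      ≤ alpha a L (k + 1) * (B / alpha a L (k + 1) + ‖gradient f x‖) := by
        gcongr
        exact (norm_sub_le _ _).trans (by gcongr; exact norm_clip_le _ (by positivity))
    _ = B + alpha a L (k + 1) * ‖gradient f x‖ := by rw [mul_add, mul_div_cancel₀ _ hα.ne']
    _ ≤ 3 * B / 2 := by linarith

lemma exponent_noise_le (hD : 0 < D) (hl : 2 ≤ l) (hp : 0 ≤ p) :
    4 * l / D ^ 2 * (p / (2 * (D / (8 * l))) * (33 / 32 * D) + p) +
      (4 * l / D ^ 2) ^ 2 * ((3 * (D / (8 * l)) / 2 + 33 / 32 * D) ^ 2 * p) ≤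
      60 * l ^ 2 / D ^ 2 * p := by
  have : 0 < l := by linarith
  have hsum : 3 * (D / (8 * l)) / 2 + 33 / 32 * D ≤ 9 / 8 * D := by
    have : D / (8 * l) ≤ D / 16 := by gcongr; linarith
    linarith
  calc _ ≤ 4 * l / D ^ 2 * (p / (2 * (D / (8 * l))) * (33 / 32 * D) + p) +
        (4 * l / D ^ 2) ^ 2 * ((9 / 8 * D) ^ 2 * p) := by gcongr
    _ = (4 * l * (33 / 8 * l + 1) + 81 / 4 * l ^ 2) / D ^ 2 * p := by field_simp; ring
    _ ≤ 60 * l ^ 2 / D ^ 2 * p := by gcongr; nlinarith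

variable {Ω : Type*} [MeasurableSpace Ω] [MeasurableSpace Ξ] {μ : Measure Ω} {P : Measure Ξ}
  {ξ : ℕ → ℕ → Ω → Ξ}

lemma IsStochasticGradient.measurable_apply (hg : IsStochasticGradient f P g σ)
    (x : EuclideanSpace ℝ (Fin n)) : Measurable (g x) :=
  hg.measurable.comp measurable_prodMk_left

lemma IsStochasticGradient.integral_sub_gradient [IsProbabilityMeasure P]
    (hg : IsStochasticGradient f P g σ) (x : EuclideanSpace ℝ (Fin n)) :
    ∫ t, (g x t - gradient f x) ∂P = 0 := by
  rw [integral_sub (hg.integrable x) (integrable_const _), hg.unbiased x, integral_const,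
    probReal_univ, one_smul, sub_self]

lemma IsIIDSample.integrable_comp (hξ : IsIIDSample μ P ξ) {F : Type*} [NormedAddCommGroup F]
    {h : Ξ → F} (hh : Integrable h P) (k i : ℕ) : Integrable (fun ω => h (ξ k i ω)) μ := by
  rw [← hξ.law k i] at hh
  exact hh.comp_measurable (hξ.measurable k i)

lemma IsIIDSample.integral_comp (hξ : IsIIDSample μ P ξ) {F : Type*} [NormedAddCommGroup F]
    [NormedSpace ℝ F] {h : Ξ → F} (hh : AEStronglyMeasurable h P) (k i : ℕ) :
    ∫ ω, h (ξ k i ω) ∂μ = ∫ t, h t ∂P := by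
  rw [← hξ.law k i] at hh ⊢
  exact (integral_map (hξ.measurable k i).aemeasurable hh).symm

lemma integrable_miniBatch (hg : IsStochasticGradient f P g σ) (hξ : IsIIDSample μ P ξ)
    (k m : ℕ) (x : EuclideanSpace ℝ (Fin n)) :
    Integrable (fun ω => miniBatch g m (fun i => ξ k i ω) x) μ :=
  (integrable_finsetSum _ fun i _ => hξ.integrable_comp (hg.integrable x) k i).smul (1 / (m : ℝ))

lemma integral_miniBatch (hg : IsStochasticGradient f P g σ) (hξ : IsIIDSample μ P ξ) (k : ℕ)
    (hm : 0 < m) (x : EuclideanSpace ℝ (Fin n)) :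
    ∫ ω, miniBatch g m (fun i => ξ k i ω) x ∂μ = gradient f x := by
  have hm' : (m : ℝ) ≠ 0 := by positivity
  simp only [miniBatch]
  rw [integral_smul, integral_finsetSum _ fun i _ => hξ.integrable_comp (hg.integrable x) k i]
  simp only [hξ.integral_comp (hg.integrable x).1, hg.unbiased x, Finset.sum_const,
    Finset.card_range]
  rw [← Nat.cast_smul_eq_nsmul ℝ, smul_smul, one_div_mul_cancel hm', one_smul]

lemma memLp_sub_gradient_sample (hg : IsStochasticGradient f P g σ) (hξ : IsIIDSample μ P ξ)
    (k i : ℕ) (x : EuclideanSpace ℝ (Fin n)) :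
    MemLp (fun ω => g x (ξ k i ω) - gradient f x) 2 μ :=
  (memLp_two_iff_integrable_sq_norm
    (((hg.measurable_apply x).comp (hξ.measurable k i)).sub_const _).aestronglyMeasurable).2
    (hξ.integrable_comp (hg.integrable_sq x) k i)

lemma memLp_miniBatch_sub (hg : IsStochasticGradient f P g σ) (hξ : IsIIDSample μ P ξ)
    (k : ℕ) (hm : 0 < m) (x : EuclideanSpace ℝ (Fin n)) :
    MemLp (fun ω => miniBatch g m (fun i => ξ k i ω) x - gradient f x) 2 μ := by
  simp only [miniBatch_sub hm]
  simp only [miniBatch]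
  exact (memLp_finsetSum _ fun i _ => memLp_sub_gradient_sample hg hξ k i x).const_smul
    (1 / (m : ℝ))

lemma integral_sq_norm_miniBatch_sub_le [IsProbabilityMeasure μ] [IsProbabilityMeasure P]
    (hg : IsStochasticGradient f P g σ) (hξ : IsIIDSample μ P ξ) (k : ℕ) (hm : 0 < m)
    (x : EuclideanSpace ℝ (Fin n)) :
    ∫ ω, ‖miniBatch g m (fun i => ξ k i ω) x - gradient f x‖ ^ 2 ∂μ ≤ σ ^ 2 / m := by
  have hmeas : Measurable fun t => g x t - gradient f x := (hg.measurable_apply x).sub_const _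
  have hmean (i : ℕ) : ∫ ω, (g x (ξ k i ω) - gradient f x) ∂μ = 0 :=
    (hξ.integral_comp hmeas.aestronglyMeasurable k i).trans (hg.integral_sub_gradient x)
  have hind : Pairwise fun i j => IndepFun (fun ω => g x (ξ k i ω) - gradient f x)
      (fun ω => g x (ξ k j ω) - gradient f x) μ := fun i j hij =>
    (hξ.indep.indepFun (i := (k, i)) (j := (k, j)) (by simpa using hij)).comp hmeas hmeas
  have hvar (i : ℕ) : ∫ ω, ‖g x (ξ k i ω) - gradient f x‖ ^ 2 ∂μ ≤ σ ^ 2 :=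
    (hξ.integral_comp (hg.integrable_sq x).1 k i).trans_le (hg.variance_le x)
  simp only [miniBatch_sub hm]
  simp only [miniBatch, norm_smul, mul_pow, Real.norm_eq_abs, sq_abs]
  rw [integral_const_mul, integral_norm_sq_sum_of_indepFun _
    (fun i => memLp_sub_gradient_sample hg hξ k i x) hmean hind]
  calc (1 / (m : ℝ)) ^ 2 * ∑ i ∈ Finset.range m, ∫ ω, ‖g x (ξ k i ω) - gradient f x‖ ^ 2 ∂μ
      ≤ (1 / (m : ℝ)) ^ 2 * ∑ i ∈ Finset.range m, σ ^ 2 := by gcongr; exact hvar _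
    _ = σ ^ 2 / m := by
        rw [Finset.sum_const, Finset.card_range, nsmul_eq_mul]
        field_simp

lemma aestronglyMeasurable_clip_miniBatch (hg : IsStochasticGradient f P g σ)
    (hξ : IsIIDSample μ P ξ) (k m : ℕ) (x : EuclideanSpace ℝ (Fin n)) (l : ℝ) :
    AEStronglyMeasurable (fun ω => clip (miniBatch g m (fun i => ξ k i ω) x) l) μ :=
  ((measurable_clip l).comp_aemeasurable
    (integrable_miniBatch hg hξ k m x).aemeasurable).aestronglyMeasurable

lemma aestronglyMeasurable_scaledError (hg : IsStochasticGradient f P g σ)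
    (hξ : IsIIDSample μ P ξ) (a L B : ℝ) (k m : ℕ) (x : EuclideanSpace ℝ (Fin n)) :
    AEStronglyMeasurable (fun ω => scaledError f g a L B k m x fun i => ξ k i ω) μ :=
  ((aestronglyMeasurable_clip_miniBatch hg hξ k m x _).sub
    (aestronglyMeasurable_const (b := gradient f x))).const_smul (alpha a L (k + 1))

variable [IsProbabilityMeasure μ] [IsProbabilityMeasure P]

lemma integral_sq_norm_scaledError_le (hg : IsStochasticGradient f P g σ)
    (hξ : IsIIDSample μ P ξ) (hm : 0 < m) (hα : 0 < alpha a L (k + 1))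
    (hx : alpha a L (k + 1) * ‖gradient f x‖ ≤ B) :
    ∫ ω, ‖scaledError f g a L B k m x (fun i => ξ k i ω)‖ ^ 2 ∂μ ≤
      alpha a L (k + 1) ^ 2 * (σ ^ 2 / m) := by
  simp only [scaledError, norm_smul, mul_pow, Real.norm_eq_abs, sq_abs]
  rw [integral_const_mul]
  gcongr
  refine le_trans (integral_mono_of_nonneg (.of_forall fun ω => by positivity)
    ((memLp_miniBatch_sub hg hξ k hm x).integrable_norm_pow two_ne_zero)
    (.of_forall fun ω => ?_)) (integral_sq_norm_miniBatch_sub_le hg hξ k hm x)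
  exact pow_le_pow_left₀ (norm_nonneg _) (norm_clip_sub_le ((le_div_iff₀' hα).2 hx)) 2

lemma norm_integral_scaledError_le (hg : IsStochasticGradient f P g σ)
    (hξ : IsIIDSample μ P ξ) (hm : 0 < m) (hα : 0 < alpha a L (k + 1)) (hB : 0 < B)
    (hx : alpha a L (k + 1) * ‖gradient f x‖ ≤ B / 2) :
    ‖∫ ω, scaledError f g a L B k m x (fun i => ξ k i ω) ∂μ‖ ≤
      alpha a L (k + 1) ^ 2 * (σ ^ 2 / m) / (2 * B) := by
  set α := alpha a L (k + 1)
  set G : Ω → EuclideanSpace ℝ (Fin n) := fun ω => miniBatch g m (fun i => ξ k i ω) x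
  have hl : 0 < B / α := div_pos hB hα
  have hclip : Integrable (fun ω => clip (G ω) (B / α)) μ :=
    .of_bound (aestronglyMeasurable_clip_miniBatch hg hξ k m x _) (B / α)
      (.of_forall fun ω => norm_clip_le _ hl.le)
  have hG : Integrable G μ := integrable_miniBatch hg hξ k m x
  have hmean : ∫ ω, scaledError f g a L B k m x (fun i => ξ k i ω) ∂μ =
      α • ∫ ω, (clip (G ω) (B / α) - G ω) ∂μ := by
    simp only [scaledError]
    rw [integral_smul, integral_sub hclip (integrable_const _), integral_sub hclip hG,
      integral_miniBatch hg hξ k hm x, integral_const, probReal_univ, one_smul]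
  have hbias : ‖∫ ω, (clip (G ω) (B / α) - G ω) ∂μ‖ ≤ σ ^ 2 / m / (2 * (B / α)) := by
    refine (norm_integral_le_of_norm_le
      (((memLp_miniBatch_sub hg hξ k hm x).integrable_norm_pow two_ne_zero).div_const _)
      (.of_forall fun ω => norm_clip_sub_self_le hl ?_)).trans ?_
    · rwa [div_right_comm, le_div_iff₀' hα]
    · rw [integral_div]
      gcongr
      exact integral_sq_norm_miniBatch_sub_le hg hξ k hm x
  calc ‖∫ ω, scaledError f g a L B k m x (fun i => ξ k i ω) ∂μ‖
      ≤ α * (σ ^ 2 / m / (2 * (B / α))) := by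
        rw [hmean, norm_smul, Real.norm_of_nonneg hα.le]
        gcongr
    _ = α ^ 2 * (σ ^ 2 / m) / (2 * B) := by field_simp

lemma lintegral_exp_noise_le (hg : IsStochasticGradient f P g σ) (hξ : IsIIDSample μ P ξ)
    (hm : 0 < m) (hα : 0 < alpha a L (k + 1)) (hD : 0 < D) (hl : 2 ≤ l) {S : State n}
    (hz : ‖S.z - xstar‖ ≤ D)
    (hx : alpha a L (k + 1) * ‖gradient f (queryPoint a L k S)‖ ≤ D / (16 * l))
    (hvar : alpha a L (k + 1) ^ 2 * (σ ^ 2 / m) ≤ p) :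
    ∫⁻ ω, ENNReal.ofReal (Real.exp (4 * l / D ^ 2 *
        noise f g xstar a L (D / (8 * l)) k m S (fun i => ξ k i ω))) ∂μ ≤
      ENNReal.ofReal (Real.exp (60 * l ^ 2 / D ^ 2 * p)) := by
  have : 0 < l := by linarith
  have hp : 0 ≤ p := le_trans (by positivity) hvar
  have hB : 0 < D / (8 * l) := by positivity
  have hxB : alpha a L (k + 1) * ‖gradient f (queryPoint a L k S)‖ ≤ D / (8 * l) / 2 :=
    hx.trans_eq (by field_simp; norm_num)
  have hD16 : D / (8 * l) ≤ D / 16 := by gcongr; linarith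
  have hw : ‖xstar - S.z + alpha a L (k + 1) • gradient f (queryPoint a L k S)‖ ≤
      33 / 32 * D := by
    refine (norm_add_le _ _).trans ?_
    rw [norm_smul, Real.norm_of_nonneg hα.le, norm_sub_rev]
    linarith
  have hexp : 4 * l / D ^ 2 * (3 * (D / (8 * l)) / 2 *
      (3 * (D / (8 * l)) / 2 + 33 / 32 * D)) ≤ 1 :=
    calc _ ≤ 4 * l / D ^ 2 * (3 * (D / (8 * l)) / 2 * (9 / 8 * D)) := by gcongr; linarith
      _ = 27 / 32 := by field_simp; norm_num
      _ ≤ 1 := by norm_num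
  refine (lintegral_exp_inner_add_sq_norm_le (e := p / (2 * (D / (8 * l))))
    (aestronglyMeasurable_scaledError hg hξ _ _ _ _ _ _)
    (by positivity) (norm_scaledError_le hα hB.le hxB <| fun i => ξ k i ·) hw
    ((integral_sq_norm_scaledError_le hg hξ hm hα (hxB.trans (half_le_self hB.le))).trans hvar)
    ((norm_integral_scaledError_le hg hξ hm hα hB hxB).trans (by gcongr)) hexp).trans ?_
  gcongr
  exact exponent_noise_le hD hl hp

end Sampling

/-! ### The exponential supermartingale -/

section Measurability

variable {n : ℕ}

/-- The `σ`-algebra on states for which the two components `y` and `z` are jointly measurable. -/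
instance : MeasurableSpace (State n) :=
  MeasurableSpace.comap (fun S => (S.y, S.z)) inferInstance

lemma State.measurable_y : Measurable (State.y : State n → EuclideanSpace ℝ (Fin n)) :=
  (comap_measurable fun S : State n => (S.y, S.z)).fst

lemma State.measurable_z : Measurable (State.z : State n → EuclideanSpace ℝ (Fin n)) :=
  (comap_measurable fun S : State n => (S.y, S.z)).snd

lemma State.measurable_mk {α : Type*} [MeasurableSpace α] {y z : α → EuclideanSpace ℝ (Fin n)}
    (hy : Measurable y) (hz : Measurable z) : Measurable fun t => State.mk (y t) (z t) :=
  measurable_comap_iff.2 (hy.prodMk hz)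

lemma measurable_queryPoint (a L : ℝ) (k : ℕ) :
    Measurable (queryPoint a L k : State n → EuclideanSpace ℝ (Fin n)) :=
  ((State.measurable_y.const_smul (bigA a L k)).add
    (State.measurable_z.const_smul (alpha a L (k + 1)))).const_smul (1 / bigA a L (k + 1))

variable {Ξ : Type*} [MeasurableSpace Ξ] {f : EuclideanSpace ℝ (Fin n) → ℝ}
  {g : EuclideanSpace ℝ (Fin n) → Ξ → EuclideanSpace ℝ (Fin n)} {L : ℝ}

lemma measurable_miniBatch (hg : Measurable (Function.uncurry g)) (m : ℕ) :
    Measurable fun p : EuclideanSpace ℝ (Fin n) × (ℕ → Ξ) => miniBatch g m p.2 p.1 :=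
  (Finset.measurable_fun_sum (Finset.range m) fun i _ => hg.comp (measurable_fst.prodMk
    ((measurable_pi_apply i).comp measurable_snd))).const_smul (1 / (m : ℝ))

lemma measurable_clip_miniBatch_queryPoint (hg : Measurable (Function.uncurry g))
    (a L l : ℝ) (k m : ℕ) :
    Measurable fun p : State n × (ℕ → Ξ) => clip (miniBatch g m p.2 (queryPoint a L k p.1)) l :=
  (measurable_clip l).comp ((measurable_miniBatch hg m).comp
    (((measurable_queryPoint a L k).comp measurable_fst).prodMk measurable_snd))

lemma measurable_step (hg : Measurable (Function.uncurry g)) (a L B : ℝ) (k m : ℕ) :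
    Measurable fun p : State n × (ℕ → Ξ) => step g a L B k m p.2 p.1 := by
  have hz : Measurable fun p : State n × (ℕ → Ξ) => (step g a L B k m p.2 p.1).z :=
    (State.measurable_z.comp measurable_fst).sub
      ((measurable_clip_miniBatch_queryPoint hg a L _ k m).const_smul (alpha a L (k + 1)))
  exact State.measurable_mk ((((State.measurable_y.comp measurable_fst).const_smul
    (bigA a L k)).add (hz.const_smul (alpha a L (k + 1)))).const_smul (1 / bigA a L (k + 1))) hz

lemma IsLSmooth.measurable_gradient (hs : IsLSmooth f L) : Measurable (gradient f) :=
  (LipschitzWith.of_dist_le' fun x y => by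
    simpa only [dist_eq_norm] using hs.gradient_lipschitz x y).continuous.measurable

lemma measurable_noise (hf : Measurable (gradient f)) (hg : Measurable (Function.uncurry g))
    (xstar : EuclideanSpace ℝ (Fin n)) (a L B : ℝ) (k m : ℕ) :
    Measurable fun p : State n × (ℕ → Ξ) => noise f g xstar a L B k m p.1 p.2 := by
  have hgrad : Measurable fun p : State n × (ℕ → Ξ) => gradient f (queryPoint a L k p.1) :=
    hf.comp ((measurable_queryPoint a L k).comp measurable_fst)
  have herror : Measurable fun p : State n × (ℕ → Ξ) =>
      scaledError f g a L B k m (queryPoint a L k p.1) p.2 :=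
    ((measurable_clip_miniBatch_queryPoint hg a L _ k m).sub hgrad).const_smul (alpha a L (k + 1))
  exact (herror.inner (𝕜 := ℝ) (((State.measurable_z.comp measurable_fst).const_sub xstar).add
    (hgrad.const_smul (alpha a L (k + 1))))).add (herror.norm.pow_const 2)

lemma measurable_trackedStep (hf : Measurable (gradient f))
    (hg : Measurable (Function.uncurry g)) (xstar : EuclideanSpace ℝ (Fin n)) (a L B T : ℝ)
    (k m : ℕ) : Measurable (Function.uncurry (trackedStep f g xstar a L B T k m)) := by
  have hstate : Measurable fun p : (State n × ℝ) × (ℕ → Ξ) => (p.1.1, p.2) :=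
    measurable_fst.fst.prodMk measurable_snd
  have hsum : Measurable fun p : (State n × ℝ) × (ℕ → Ξ) => p.1.2 := measurable_fst.snd
  have hnoise := (measurable_noise hf hg xstar a L B k m).comp hstate
  have hstep := (measurable_step hg a L B k m).comp hstate
  exact hstep.prodMk (hsum.add (hnoise.ite (measurableSet_le hsum measurable_const)
    measurable_const))

lemma measurable_tracked {Ω : Type*} [MeasurableSpace Ω] {ξ : ℕ → ℕ → Ω → Ξ}
    (hf : Measurable (gradient f)) (hg : Measurable (Function.uncurry g))
    (hξ : ∀ k i, Measurable (ξ k i)) (xstar x0 : EuclideanSpace ℝ (Fin n)) (a L B T : ℝ)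
    (m : ℕ → ℕ) (k : ℕ) :
    Measurable fun ω => tracked f g xstar x0 a L B T m (fun k i => ξ k i ω) k :=
  measurable_driven_of_measurable (fun k => measurable_trackedStep hf hg _ _ _ _ _ k (m k))
    (fun k => measurable_pi_lambda _ (hξ k)) k

end Measurability

section Tail

variable {n : ℕ} {Ω Ξ : Type*} [MeasurableSpace Ω] [MeasurableSpace Ξ] {μ : Measure Ω}
  {P : Measure Ξ} [IsProbabilityMeasure μ] [IsProbabilityMeasure P]
  {f : EuclideanSpace ℝ (Fin n) → ℝ}
  {g : EuclideanSpace ℝ (Fin n) → Ξ → EuclideanSpace ℝ (Fin n)} {ξ : ℕ → ℕ → Ω → Ξ}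
  {σ a L T D R0 l p : ℝ} {m : ℕ → ℕ} {xstar x0 : EuclideanSpace ℝ (Fin n)}

lemma lintegral_exp_trackedStep_le (hc : ConvexOn ℝ Set.univ f) (hs : IsLSmooth f L)
    (hg : IsStochasticGradient f P g σ) (hξ : IsIIDSample μ P ξ)
    (hmin : IsMinOn f Set.univ xstar) (hL : 0 < L) (ha1 : 1 ≤ a) (hl : 2 ≤ l)
    (ha : 36 * (2 * l + √(4 * l ^ 2 + 2 * l)) ^ 2 ≤ a) (hD : 0 < D) (hT : 0 ≤ T)
    (hDT : ‖x0 - xstar‖ ^ 2 + 2 * T ≤ D ^ 2) {k : ℕ} (hm : 0 < m k)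
    (hvar : alpha a L (k + 1) ^ 2 * (σ ^ 2 / m k) ≤ p) (s : ℕ → ℕ → Ξ) :
    ∫⁻ ω, ENNReal.ofReal (Real.exp (4 * l / D ^ 2 *
        (trackedStep f g xstar a L (D / (8 * l)) T k (m k)
          (tracked f g xstar x0 a L (D / (8 * l)) T m s k) (fun i => ξ k i ω)).2)) ∂μ ≤
      ENNReal.ofReal (Real.exp (60 * l ^ 2 / D ^ 2 * p)) * ENNReal.ofReal (Real.exp (4 * l / D ^ 2 *
        (tracked f g xstar x0 a L (D / (8 * l)) T m s k).2)) := by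
  have ha0 : 0 < a := one_pos.trans_le ha1
  have hp : 0 ≤ p := le_trans (by positivity) hvar
  simp only [trackedStep, mul_add, Real.exp_add, ENNReal.ofReal_mul (Real.exp_pos _).le]
  rw [lintegral_const_mul' _ _ ENNReal.ofReal_ne_top, mul_comm (ENNReal.ofReal _)]
  gcongr
  by_cases hW : (tracked f g xstar x0 a L (D / (8 * l)) T m s k).2 ≤ T
  · have hpot := (potential_tracked_le hc hs hL ha1 hW).trans
      (by linarith : _ ≤ D ^ 2 / 2)
    have hz := norm_z_sub_le_of_potential_le ha0 hL hmin hD.le hpot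
    have hy := norm_y_sub_le_of_snd_tracked_le hc hs hL ha1 hmin hD.le hT hDT hW
    have hgap := (le_add_of_nonneg_right (by positivity)).trans hpot
    simp only [if_pos hW]
    refine lintegral_exp_noise_le hg hξ hm (alpha_succ_pos ha0 hL k) hD hl hz ?_ hvar
    refine (alpha_mul_norm_gradient_queryPoint_le hs hL ha0 hmin hy hz hgap).trans ?_
    rw [div_eq_mul_one_div D]
    exact mul_le_mul_of_nonneg_left (two_div_add_le_of_le (by linarith) ha) hD.le
  · simp only [if_neg hW, mul_zero, Real.exp_zero, lintegral_const, measure_univ, mul_one]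
    exact ENNReal.ofReal_le_ofReal (Real.one_le_exp (by positivity))

lemma lintegral_exp_tracked_le (hc : ConvexOn ℝ Set.univ f) (hs : IsLSmooth f L)
    (hg : IsStochasticGradient f P g σ) (hξ : IsIIDSample μ P ξ)
    (hmin : IsMinOn f Set.univ xstar) (hL : 0 < L) (ha1 : 1 ≤ a) (hl : 2 ≤ l)
    (ha : 36 * (2 * l + √(4 * l ^ 2 + 2 * l)) ^ 2 ≤ a) (hD : 0 < D) (hT : 0 ≤ T)
    (hDT : ‖x0 - xstar‖ ^ 2 + 2 * T ≤ D ^ 2) (hm : ∀ k, 0 < m k)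
    (hvar : ∀ k, alpha a L (k + 1) ^ 2 * (σ ^ 2 / m k) ≤ p) (N : ℕ) :
    ∫⁻ ω, ENNReal.ofReal (Real.exp (4 * l / D ^ 2 *
        (tracked f g xstar x0 a L (D / (8 * l)) T m (fun k i => ξ k i ω) N).2)) ∂μ ≤
      ENNReal.ofReal (Real.exp (N * (60 * l ^ 2 / D ^ 2 * p))) := by
  refine (lintegral_driven_le
    (φ := fun q : State n × ℝ => ENNReal.ofReal (Real.exp (4 * l / D ^ 2 * q.2)))
    (fun k => measurable_trackedStep hs.measurable_gradient hg.measurable _ _ _ _ _ k (m k))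
    (fun k => measurable_pi_lambda _ (hξ.measurable k))
    (iIndepFun_pi_of_iIndepFun_prod hξ.measurable hξ.indep)
    (measurable_snd.const_mul _).exp.ennreal_ofReal (fun k ω =>
      lintegral_exp_trackedStep_le hc hs hg hξ hmin hL ha1 hl ha hD hT hDT (hm k) (hvar k) _)
    N).trans_eq ?_
  rw [mul_zero, Real.exp_zero, ENNReal.ofReal_one, mul_one,
    ← ENNReal.ofReal_pow (Real.exp_pos _).le, ← Real.exp_nat_mul]

lemma measureReal_lt_snd_tracked_le (hc : ConvexOn ℝ Set.univ f) (hs : IsLSmooth f L)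
    (hg : IsStochasticGradient f P g σ) (hξ : IsIIDSample μ P ξ)
    (hmin : IsMinOn f Set.univ xstar) (hL : 0 < L) (ha1 : 1 ≤ a) (hl : 2 ≤ l)
    (ha : 36 * (2 * l + √(4 * l ^ 2 + 2 * l)) ^ 2 ≤ a) (hD : 0 < D)
    (hR : ‖x0 - xstar‖ = R0) (hDR : D ^ 2 = 5 * R0 ^ 2) {N : ℕ} (hN : 0 < N) (hm : ∀ k, 0 < m k)
    (hvar : ∀ k, alpha a L (k + 1) ^ 2 * (σ ^ 2 / m k) ≤ D ^ 2 / (6000 * N * l)) :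
    μ.real {ω | 2 * R0 ^ 2 < (tracked f g xstar x0 a L (D / (8 * l)) (2 * R0 ^ 2) m
      (fun k i => ξ k i ω) N).2} ≤ Real.exp (-l) := by
  have : 0 < l := by linarith
  have hexp := lintegral_exp_tracked_le (T := 2 * R0 ^ 2) hc hs hg hξ hmin hL ha1 hl ha hD
    (by positivity) (by rw [hR]; linarith) hm hvar N
  have hmeas := measurable_tracked hs.measurable_gradient hg.measurable hξ.measurable xstar x0 a L
    (D / (8 * l)) (2 * R0 ^ 2) m N
  refine (measureReal_lt_le_exp_sub_mul hmeas.snd.aemeasurable (by positivity) hexp).trans ?_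
  have hR2 : R0 ^ 2 = D ^ 2 / 5 := by linarith
  have hdrift : N * (60 * l ^ 2 / D ^ 2 * (D ^ 2 / (6000 * N * l))) = l / 100 := by
    field_simp; norm_num
  have hlevel : 4 * l / D ^ 2 * (2 * R0 ^ 2) = 8 / 5 * l := by rw [hR2]; field_simp; norm_num
  rw [hdrift, hlevel]
  gcongr
  linarith

end Tail

/-! ### The parameters -/

section Parameters

variable {L σ R0 a β : ℝ} {N : ℕ}

lemma constC_sq : constC ^ 2 = 5 := Real.sq_sqrt (by norm_num)

lemma constC_pos : 0 < constC := Real.sqrt_pos.2 (by norm_num)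

lemma exp_neg_logFactor_le (hβ : 0 < β) (hN : 1 ≤ N) : Real.exp (-logFactor N β) ≤ β := by
  have hN' : (1 : ℝ) ≤ N := by exact_mod_cast hN
  rw [Real.exp_neg, logFactor, Real.exp_log (by positivity), inv_div]
  exact div_le_self hβ.le (by linarith)

lemma mul_sq_le_aMin (hl : 0 ≤ logFactor N β) : 576 * logFactor N β ^ 2 ≤ aMin β N := by
  have hsqrt : 2 * logFactor N β ≤ √(4 * logFactor N β ^ 2 + 2 * logFactor N β) :=
    Real.le_sqrt_of_sq_le (by linarith)
  calc 576 * logFactor N β ^ 2 = 36 * (2 * logFactor N β + 2 * logFactor N β) ^ 2 := by ring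
    _ ≤ 36 * (2 * logFactor N β + √(4 * logFactor N β ^ 2 + 2 * logFactor N β)) ^ 2 := by gcongr
    _ ≤ aMin β N := (le_max_right _ _).trans (le_max_right _ _)

lemma aMin_le (hl : 2 ≤ logFactor N β) : aMin β N ≤ 650 * logFactor N β ^ 2 := by
  have hC : 1 ≤ constC := Real.one_le_sqrt.2 (by norm_num)
  have hsqrt : √(4 * logFactor N β ^ 2 + 2 * logFactor N β) ≤ 2.24 * logFactor N β :=
    Real.sqrt_le_iff.2 ⟨by linarith, by nlinarith⟩
  refine max_le (by nlinarith) (max_le ?_ ?_)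
  · exact (div_le_self (by linarith) hC).trans (by nlinarith)
  · calc 36 * (2 * logFactor N β + √(4 * logFactor N β ^ 2 + 2 * logFactor N β)) ^ 2
        ≤ 36 * (2 * logFactor N β + 2.24 * logFactor N β) ^ 2 := by gcongr
      _ ≤ 650 * logFactor N β ^ 2 := by nlinarith

lemma batchSize_pos (L σ R0 a β : ℝ) (N k : ℕ) : 0 < batchSize L σ R0 a β N k :=
  Nat.ceil_pos.2 (one_pos.trans_le (le_max_left _ _))

lemma sq_alpha_mul_variance_le (hR0 : 0 < R0) (hN : 0 < N) (hl : 0 < logFactor N β) (k : ℕ) :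
    alpha a L (k + 1) ^ 2 * (σ ^ 2 / batchSize L σ R0 a β N k) ≤
      (constC * R0) ^ 2 / (6000 * N * logFactor N β) := by
  have hm : (0 : ℝ) < batchSize L σ R0 a β N k := by
    exact_mod_cast batchSize_pos L σ R0 a β N k
  have hbatch : 6000 * σ ^ 2 * alpha a L (k + 1) ^ 2 * (N : ℝ) * logFactor N β /
      (constC ^ 2 * R0 ^ 2) ≤ batchSize L σ R0 a β N k :=
    ((le_max_left _ _).trans (le_max_right _ _)).trans (Nat.le_ceil _)
  have hC : 0 < constC ^ 2 * R0 ^ 2 := by rw [constC_sq]; positivity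
  rw [div_le_iff₀ hC] at hbatch
  rw [← mul_div_assoc, div_le_div_iff₀ hm (by positivity), mul_pow]
  linarith

lemma batchSize_le (hl : 2 ≤ logFactor N β) (k : ℕ) :
    (batchSize L σ R0 a β N k : ℝ) ≤
      2 + 1200 * (σ ^ 2 * alpha a L (k + 1) ^ 2 * N * logFactor N β / R0 ^ 2) := by
  set t := σ ^ 2 * alpha a L (k + 1) ^ 2 * N / R0 ^ 2 with ht
  have hlt : 2 * t ≤ logFactor N β * t := by gcongr
  have hfirst : 6000 * σ ^ 2 * alpha a L (k + 1) ^ 2 * (N : ℝ) * logFactor N β /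
      (constC ^ 2 * R0 ^ 2) = 1200 * (logFactor N β * t) := by rw [constC_sq, ht]; ring
  have hsecond : 10368 * σ ^ 2 * alpha a L (k + 1) ^ 2 * (N : ℝ) / (constC ^ 2 * R0 ^ 2) =
      10368 / 5 * t := by rw [constC_sq, ht]; ring
  have ht0 : 0 ≤ t := by positivity
  calc (batchSize L σ R0 a β N k : ℝ)
      ≤ max 1 (max (1200 * (logFactor N β * t)) (10368 / 5 * t)) + 1 := by
        rw [batchSize, hfirst, hsecond]
        exact (Nat.ceil_lt_add_one (zero_le_one.trans (le_max_left _ _))).le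
    _ ≤ 1 + 1200 * (logFactor N β * t) + 1 := by
        gcongr
        exact max_le (by linarith) (max_le (by linarith) (by linarith))
    _ = 2 + 1200 * (σ ^ 2 * alpha a L (k + 1) ^ 2 * N * logFactor N β / R0 ^ 2) := by
        rw [ht]; ring

lemma alpha_aMin_succ_le (hL : 0 < L) (hl : 0 < logFactor N β) {k : ℕ} (hk : k < N) :
    alpha (aMin β N) L (k + 1) ≤ N / (576 * logFactor N β ^ 2 * L) := by
  have hk' : (k : ℝ) + 1 ≤ N := by exact_mod_cast hk
  have ha := mul_sq_le_aMin hl.le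
  calc ((k : ℝ) + 2) / (2 * aMin β N * L)
      ≤ (2 * N) / (2 * (576 * logFactor N β ^ 2) * L) := by gcongr; linarith
    _ = N / (576 * logFactor N β ^ 2 * L) := by field_simp

lemma oracleCalls_batchSize_le (hL : 0 < L) (hR0 : 0 < R0) (hl : 2 ≤ logFactor N β) :
    (oracleCalls (batchSize L σ R0 (aMin β N) β N) N : ℝ) ≤
      2 * N + σ ^ 2 * (N : ℝ) ^ 4 / (logFactor N β ^ 3 * L ^ 2 * R0 ^ 2) := by
  have hl0 : 0 < logFactor N β := by linarith
  have ha0 : 0 < aMin β N := one_pos.trans_le (le_max_left _ _)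
  rw [oracleCalls, Nat.cast_sum]
  calc ∑ k ∈ Finset.range N, (batchSize L σ R0 (aMin β N) β N k : ℝ)
      ≤ ∑ k ∈ Finset.range N, (2 + 1200 * (σ ^ 2 * ((N : ℝ) /
          (576 * logFactor N β ^ 2 * L)) ^ 2 * N * logFactor N β / R0 ^ 2)) := by
        refine Finset.sum_le_sum fun k hk => (batchSize_le hl k).trans ?_
        have hα := (alpha_succ_pos ha0 hL k).le
        gcongr
        exact alpha_aMin_succ_le hL hl0 (Finset.mem_range.1 hk)
    _ = 2 * N + 1200 / 576 ^ 2 *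
          (σ ^ 2 * (N : ℝ) ^ 4 / (logFactor N β ^ 3 * L ^ 2 * R0 ^ 2)) := by
        rw [Finset.sum_const, Finset.card_range, nsmul_eq_mul]
        field_simp
    _ ≤ 2 * N + σ ^ 2 * (N : ℝ) ^ 4 / (logFactor N β ^ 3 * L ^ 2 * R0 ^ 2) := by
        gcongr
        exact mul_le_of_le_one_left (by positivity) (by norm_num)

end Parameters

/-! ### The number of iterations -/

section Iterations

variable {L σ R0 β X ε : ℝ} {N : ℕ}

lemma half_le_log_div (hX : 2 ≤ X) (hβ : 0 < β) (hβ1 : β < 1) : 1 / 2 ≤ Real.log (X / β) := by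
  have hXβ : X ≤ X / β := le_div_self (by linarith) hβ hβ1.le
  have hlog : Real.log 2 ≤ Real.log (X / β) := Real.log_le_log (by norm_num) (hX.trans hXβ)
  linarith [Real.log_two_gt_d9]

lemma two_le_logFactor (hβ : 0 < β) (hβ1 : β < 1) (hN : 2 ≤ N) : 2 ≤ logFactor N β := by
  have hN' : (2 : ℝ) ≤ N := by exact_mod_cast hN
  have hNβ : 4 * (N : ℝ) ≤ 4 * N / β := le_div_self (by positivity) hβ hβ1.le
  rw [logFactor, Real.le_log_iff_exp_le (by positivity)]
  calc Real.exp 2 = Real.exp 1 ^ 2 := by rw [← Real.exp_nat_mul]; norm_num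
    _ ≤ 2.7182818286 ^ 2 := by gcongr; exact Real.exp_one_lt_d9.le
    _ ≤ 4 * N / β := by norm_num; linarith

lemma logFactor_le_of_le (hX : 2 ≤ X) (hβ : 0 < β) (hβ1 : β < 1) (hN : 1 ≤ N)
    (hNX : (N : ℝ) ≤ 2048 * (√X * Real.log (X / β))) :
    logFactor N β ≤ 15 * Real.log (X / β) := by
  have hX0 : 0 < X := by linarith
  have hexp : Real.exp (Real.log (X / β)) = X / β := Real.exp_log (by positivity)
  have hXβ : 2 ≤ X / β := hX.trans (le_div_self hX0.le hβ hβ1.le)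
  have hsqrt : √X ≤ X := Real.sqrt_le_self_iff.2 (.inr (by linarith))
  have hlog : Real.log (X / β) ≤ X / β := Real.log_le_self (by positivity)
  rw [logFactor, Real.log_le_iff_le_exp (by positivity)]
  calc 4 * (N : ℝ) / β ≤ 4 * (2048 * (√X * Real.log (X / β))) / β := by gcongr
    _ = 2 ^ 13 * (√X / β) * Real.log (X / β) := by ring
    _ ≤ (X / β) ^ 13 * (X / β) * (X / β) := by gcongr; exact Real.log_nonneg (by linarith)
    _ = Real.exp (15 * Real.log (X / β)) := by
        rw [← pow_succ, ← pow_succ, ← hexp, ← Real.exp_nat_mul, hexp]; norm_num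

lemma log_div_le_of_sqrt_le (hX : 0 < X) (hβ : 0 < β) (hβ1 : β < 1) (hN : √X ≤ N) :
    Real.log (X / β) ≤ 2 * logFactor N β := by
  have hN0 : 0 < (N : ℝ) := (Real.sqrt_pos.2 hX).trans_le hN
  calc Real.log (X / β) ≤ Real.log ((4 * (N : ℝ) / β) ^ 2) := by
        refine Real.log_le_log (by positivity) ?_
        rw [div_pow]
        gcongr
        · exact (Real.sqrt_le_left (by positivity)).1 (hN.trans (by linarith))
        · exact pow_le_of_le_one hβ.le hβ1.le two_ne_zero
    _ = 2 * logFactor N β := by rw [Real.log_pow, logFactor, Nat.cast_ofNat]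

lemma exists_iterations (hX : 2 ≤ X) (hβ : 0 < β) (hβ1 : β < 1) :
    ∃ N : ℕ, 1 ≤ N ∧ 2 ≤ logFactor N β ∧ 6500 * logFactor N β ^ 2 * X ≤ (N : ℝ) ^ 2 ∧
      (N : ℝ) ≤ 2048 * (√X * Real.log (X / β)) ∧ Real.log (X / β) ≤ 2 * logFactor N β := by
  have hX0 : 0 < X := by linarith
  have hΛ := half_le_log_div hX hβ hβ1
  have hsqrt : 1 ≤ √X := Real.one_le_sqrt.2 (by linarith)
  set Λ := Real.log (X / β)
  set N := ⌈2046 * (√X * Λ)⌉₊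
  have hlower : 2046 * (√X * Λ) ≤ N := Nat.le_ceil _
  have hupper : (N : ℝ) ≤ 2048 * (√X * Λ) := by
    have := (Nat.ceil_lt_add_one (show 0 ≤ 2046 * (√X * Λ) by positivity)).le
    nlinarith
  have hN2 : 2 ≤ N := by
    have : (2 : ℝ) ≤ N := by nlinarith
    exact_mod_cast this
  have hl := two_le_logFactor hβ hβ1 hN2
  refine ⟨N, by omega, hl, ?_, hupper, log_div_le_of_sqrt_le hX0 hβ hβ1 (by nlinarith)⟩
  calc 6500 * logFactor N β ^ 2 * X ≤ 6500 * (15 * Λ) ^ 2 * X := by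
        gcongr; exact logFactor_le_of_le hX hβ hβ1 (by omega) hupper
    _ ≤ 2046 ^ 2 * (X * Λ ^ 2) := by nlinarith [show 0 ≤ X * Λ ^ 2 by positivity]
    _ = (2046 * (√X * Λ)) ^ 2 := by rw [mul_pow, mul_pow √X, Real.sq_sqrt hX0.le]
    _ ≤ (N : ℝ) ^ 2 := by gcongr

lemma two_mul_aMin_div_le (hL : 0 < L) (hε : 0 < ε) (hN : 1 ≤ N) (hl : 2 ≤ logFactor N β)
    (hNε : 6500 * logFactor N β ^ 2 * (L * R0 ^ 2 / ε) ≤ (N : ℝ) ^ 2) :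
    2 * aMin β N * L * constC ^ 2 * R0 ^ 2 / (N * (N + 3)) ≤ ε := by
  have ha := aMin_le hl
  rw [constC_sq, div_le_iff₀ (by positivity)]
  rw [mul_div_assoc', div_le_iff₀ hε] at hNε
  calc 2 * aMin β N * L * 5 * R0 ^ 2
      ≤ 2 * (650 * logFactor N β ^ 2) * L * 5 * R0 ^ 2 := by gcongr
    _ = 6500 * logFactor N β ^ 2 * (L * R0 ^ 2) := by ring
    _ ≤ N ^ 2 * ε := hNε
    _ ≤ ε * (N * (N + 3)) := by nlinarith [show 0 ≤ ε * N by positivity]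

lemma oracleCalls_batchSize_le_max_mul_log (hL : 0 < L) (hR0 : 0 < R0) (hε : 0 < ε)
    (hX : 1 < L * R0 ^ 2 / ε / β) (hl : 2 ≤ logFactor N β)
    (hNX : (N : ℝ) ≤ 2048 * (√(L * R0 ^ 2 / ε) * Real.log (L * R0 ^ 2 / ε / β)))
    (hΛ : Real.log (L * R0 ^ 2 / ε / β) ≤ 2 * logFactor N β) :
    (oracleCalls (batchSize L σ R0 (aMin β N) β N) N : ℝ) ≤
      2 ^ 48 * (max (√(L * R0 ^ 2 / ε)) (σ ^ 2 * R0 ^ 2 / ε ^ 2) *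
        Real.log (L * R0 ^ 2 / ε / β)) := by
  have hΛ0 := Real.log_pos hX
  set Λ := Real.log (L * R0 ^ 2 / ε / β)
  set M := max (√(L * R0 ^ 2 / ε)) (σ ^ 2 * R0 ^ 2 / ε ^ 2)
  have hlog : Λ / 2 ≤ logFactor N β := by linarith
  have hN4 : (N : ℝ) ^ 4 ≤ 2048 ^ 4 * (L * R0 ^ 2 / ε) ^ 2 * Λ ^ 4 :=
    calc (N : ℝ) ^ 4 ≤ (2048 * (√(L * R0 ^ 2 / ε) * Λ)) ^ 4 := by gcongr
      _ = 2048 ^ 4 * (√(L * R0 ^ 2 / ε) ^ 2) ^ 2 * Λ ^ 4 := by ring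
      _ = 2048 ^ 4 * (L * R0 ^ 2 / ε) ^ 2 * Λ ^ 4 := by rw [Real.sq_sqrt (by positivity)]
  have hiterations : (N : ℝ) ≤ 2048 * (M * Λ) :=
    hNX.trans (by gcongr; exact le_max_left _ _)
  have hvariance : σ ^ 2 * (N : ℝ) ^ 4 / (logFactor N β ^ 3 * L ^ 2 * R0 ^ 2) ≤
      8 * 2048 ^ 4 * (M * Λ) :=
    calc _ ≤ σ ^ 2 * (2048 ^ 4 * (L * R0 ^ 2 / ε) ^ 2 * Λ ^ 4) /
          ((Λ / 2) ^ 3 * L ^ 2 * R0 ^ 2) := by gcongr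
      _ = 8 * 2048 ^ 4 * (σ ^ 2 * R0 ^ 2 / ε ^ 2 * Λ) := by field_simp; ring
      _ ≤ 8 * 2048 ^ 4 * (M * Λ) := by gcongr; exact le_max_right _ _
  have : 0 ≤ M * Λ := by positivity
  linarith [oracleCalls_batchSize_le (σ := σ) hL hR0 hl]

end Iterations

/-! ### The high-probability bound -/

section Output

variable {n : ℕ} {Ξ : Type*} {f : EuclideanSpace ℝ (Fin n) → ℝ}
  {g : EuclideanSpace ℝ (Fin n) → Ξ → EuclideanSpace ℝ (Fin n)}
  {x0 xstar : EuclideanSpace ℝ (Fin n)} {L σ R0 a B β : ℝ} {N : ℕ}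

lemma run_gap_le_of_snd_tracked_le (hc : ConvexOn ℝ Set.univ f) (hs : IsLSmooth f L)
    (hL : 0 < L) (ha : 1 ≤ a) (hN : 0 < N) {m : ℕ → ℕ} {s : ℕ → ℕ → Ξ}
    (hR : ‖x0 - xstar‖ = R0)
    (hnoise : (tracked f g xstar x0 a L B (2 * R0 ^ 2) m s N).2 ≤ 2 * R0 ^ 2) :
    f (run g x0 a L B m s N).y - f xstar ≤
      2 * a * L * constC ^ 2 * R0 ^ 2 / ((N : ℝ) * ((N : ℝ) + 3)) := by
  have hpot := potential_tracked_le hc hs hL ha hnoise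
  rw [fst_tracked, potential, bigA_eq, hR] at hpot
  have hgap : (N : ℝ) * (N + 3) / (4 * a * L) * (f (run g x0 a L B m s N).y - f xstar) ≤
      5 * R0 ^ 2 / 2 := by
    linarith [sq_nonneg ‖(run g x0 a L B m s N).z - xstar‖]
  rw [constC_sq, le_div_iff₀ (by positivity)]
  rw [div_mul_eq_mul_div, div_le_iff₀ (by positivity)] at hgap
  linarith

variable [MeasurableSpace Ξ] {Ω : Type*} [MeasurableSpace Ω] {μ : Measure Ω} {P : Measure Ξ}
  {ξ : ℕ → ℕ → Ω → Ξ}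

lemma le_measureReal_output_gap_le [IsProbabilityMeasure μ] [IsProbabilityMeasure P]
    (hL : 0 < L) (hβ : 0 < β) (hN : 1 ≤ N) (hl : 2 ≤ logFactor N β)
    (hc : ConvexOn ℝ Set.univ f) (hs : IsLSmooth f L) (hg : IsStochasticGradient f P g σ)
    (hξ : IsIIDSample μ P ξ) (hmin : IsMinOn f Set.univ xstar) (hR : ‖x0 - xstar‖ = R0)
    (hR0 : 0 < R0) (ha : aMin β N ≤ a) :
    1 - β ≤ μ.real {ω | f (output g x0 L σ R0 a β N (fun k i => ξ k i ω)) - f xstar ≤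
      2 * a * L * constC ^ 2 * R0 ^ 2 / ((N : ℝ) * ((N : ℝ) + 3))} := by
  have ha1 : 1 ≤ a := (le_max_left _ _).trans ha
  have ha2 := ((le_max_right _ _).trans (le_max_right _ _)).trans ha
  have hDR : (constC * R0) ^ 2 = 5 * R0 ^ 2 := by rw [mul_pow, constC_sq]
  have hbad := measureReal_lt_snd_tracked_le hc hs hg hξ hmin hL ha1 hl ha2
    (mul_pos constC_pos hR0) hR hDR hN (batchSize_pos L σ R0 a β N)
    (sq_alpha_mul_variance_le hR0 hN (by linarith))
  set W := fun ω => (tracked f g xstar x0 a L (clipParam R0 β N) (2 * R0 ^ 2)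
    (batchSize L σ R0 a β N) (fun k i => ξ k i ω) N).2
  have hW : Measurable W := (measurable_tracked hs.measurable_gradient hg.measurable hξ.measurable
    xstar x0 a L (clipParam R0 β N) (2 * R0 ^ 2) (batchSize L σ R0 a β N) N).snd
  calc 1 - β ≤ 1 - μ.real {ω | 2 * R0 ^ 2 < W ω} := by
        gcongr
        exact hbad.trans (exp_neg_logFactor_le hβ hN)
    _ = μ.real {ω | 2 * R0 ^ 2 < W ω}ᶜ :=
        (probReal_compl_eq_one_sub (measurableSet_lt measurable_const hW)).symm
    _ ≤ _ := measureReal_mono fun ω hω =>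
        run_gap_le_of_snd_tracked_le hc hs hL ha1 hN hR (not_lt.1 hω)

end Output

end ClippedSSTM

theorem mainTheorem1 :
    -- the high-probability bound, for every admissible `a`
    (∀ (n : ℕ) (Ξ : Type*) (Ω : Type*) [MeasurableSpace Ξ] [MeasurableSpace Ω]
        (P : Measure Ξ) (μ : Measure Ω) [IsProbabilityMeasure P] [IsProbabilityMeasure μ]
        (f : EuclideanSpace ℝ (Fin n) → ℝ)
        (g : EuclideanSpace ℝ (Fin n) → Ξ → EuclideanSpace ℝ (Fin n))
        (ξ : ℕ → ℕ → Ω → Ξ) (x0 xstar : EuclideanSpace ℝ (Fin n))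
        (L σ R0 a β : ℝ) (N : ℕ),
      0 < L → 0 ≤ σ → 0 < β → β < 1 → 1 ≤ N → 2 ≤ Real.log (4 * (N : ℝ) / β) →
      ConvexOn ℝ Set.univ f →
      ClippedSSTM.IsLSmooth f L →
      ClippedSSTM.IsStochasticGradient f P g σ →
      ClippedSSTM.IsIIDSample μ P ξ →
      IsMinOn f Set.univ xstar →
      ‖x0 - xstar‖ = R0 → 0 < R0 →
      ClippedSSTM.aMin β N ≤ a →
      1 - β ≤ μ.real {ω |
        f (ClippedSSTM.output g x0 L σ R0 a β N (fun k i => ξ k i ω)) - f xstar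
          ≤ 2 * a * L * ClippedSSTM.constC ^ 2 * R0 ^ 2 / ((N : ℝ) * ((N : ℝ) + 3))}) ∧
    -- the iteration and oracle complexity, with `a` equal to the threshold
    (∃ K : ℝ, 0 < K ∧ ∀ L σ R0 ε β : ℝ,
      0 < L → 0 ≤ σ → 0 < R0 → 0 < β → β < 1 → 0 < ε → ε ≤ L * R0 ^ 2 / 2 →
      ∃ N : ℕ, 1 ≤ N ∧ 2 ≤ Real.log (4 * (N : ℝ) / β) ∧
        (N : ℝ) ≤ K * (√(L * R0 ^ 2 / ε) * Real.log (L * R0 ^ 2 / (ε * β))) ∧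
        (ClippedSSTM.oracleCalls
            (ClippedSSTM.batchSize L σ R0 (ClippedSSTM.aMin β N) β N) N : ℝ)
          ≤ K * (max (√(L * R0 ^ 2 / ε)) (σ ^ 2 * R0 ^ 2 / ε ^ 2)
              * Real.log (L * R0 ^ 2 / (ε * β))) ∧
        ∀ (n : ℕ) (Ξ : Type*) (Ω : Type*) [MeasurableSpace Ξ] [MeasurableSpace Ω]
          (P : Measure Ξ) (μ : Measure Ω) [IsProbabilityMeasure P] [IsProbabilityMeasure μ]
          (f : EuclideanSpace ℝ (Fin n) → ℝ)
          (g : EuclideanSpace ℝ (Fin n) → Ξ → EuclideanSpace ℝ (Fin n))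
          (ξ : ℕ → ℕ → Ω → Ξ) (x0 xstar : EuclideanSpace ℝ (Fin n)),
          ConvexOn ℝ Set.univ f →
          ClippedSSTM.IsLSmooth f L →
          ClippedSSTM.IsStochasticGradient f P g σ →
          ClippedSSTM.IsIIDSample μ P ξ →
          IsMinOn f Set.univ xstar →
          ‖x0 - xstar‖ = R0 →
          1 - β ≤ μ.real {ω |
            f (ClippedSSTM.output g x0 L σ R0 (ClippedSSTM.aMin β N) β N
                (fun k i => ξ k i ω)) - f xstar ≤ ε}) := by
  refine ⟨?_, 2 ^ 48, by norm_num, ?_⟩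
  · intro n Ξ Ω _ _ P μ _ _ f g ξ x0 xstar L σ R0 a β N hL _ hβ _ hN hl hc hs hg hξ hmin hR hR0 ha
    exact ClippedSSTM.le_measureReal_output_gap_le hL hβ hN hl hc hs hg hξ hmin hR hR0 ha
  · intro L σ R0 ε β hL _ hR0 hβ hβ1 hε hεL
    have hX : 2 ≤ L * R0 ^ 2 / ε := by rw [le_div_iff₀ hε]; linarith
    have hXβ : 1 < L * R0 ^ 2 / ε / β := by rw [one_lt_div hβ]; linarith
    obtain ⟨N, hN, hl, hNε, hNX, hΛ⟩ := ClippedSSTM.exists_iterations hX hβ hβ1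
    rw [← div_div]
    have hΛ0 := Real.log_pos hXβ
    refine ⟨N, hN, hl, hNX.trans (by gcongr; norm_num),
      ClippedSSTM.oracleCalls_batchSize_le_max_mul_log hL hR0 hε hXβ hl hNX hΛ, ?_⟩
    intro n Ξ Ω _ _ P μ _ _ f g ξ x0 xstar hc hs hg hξ hmin hR
    exact (ClippedSSTM.le_measureReal_output_gap_le hL hβ hN hl hc hs hg hξ hmin hR hR0
      le_rfl).trans (measureReal_mono fun ω hω =>
        le_trans hω (ClippedSSTM.two_mul_aMin_div_le hL hε hN hl hNε))
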